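/- **Theorem 5.3 (weak–strong uniqueness).** Let $s>0$, $\nu>0$, $0<T<\infty$, let $\mathbb T^3=(\mathbb R/\mathbb Z)^3$, $A=-\Delta$, with $A^{r}f=\sum_{k\in\mathbb Z^3}|2\pi k|^{2r}\hat f(k)e^{2\pi i k\cdot x}$, and let $u_0\in L^2(\mathbb T^3;\mathbb R^3)$ with $\operatorname{div}u_0=0$. Consider the fractional Navier–Stokes equations $$\partial_t u+(u\cdot\nabla)u+\nu A^s u=-\nabla P,\qquad \operatorname{div}u=0 .$$ A *weak solution* on $[0,T]$ with initial data $u_0$ is a function $u\in L^\infty((0,T);L^2(\mathbb T^3))\cap L^2((0,T);H^s(\mathbb T^3))$ with $\operatorname{div}u(t)=0$ (in the sense of distributions) for almost every $t$, for which there is a pressure $P\in L^1((0,T)\times\mathbb T^3)$ such that $$\int_0^T\!\!\int_{\mathbb T^3}\Big[u\cdot\partial_t\psi-\nu\,A^{s/2}u\cdot A^{s/2}\psi+u\otimes u:\nabla\psi+P\,\nabla\cdot\psi\Big]\,dx\,dt=-\int_{\mathbb T^3}u_0\cdot\psi(x,0)\,dx$$ for every $\psi\in\mathcal D(\mathbb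 T^3\times[0,T))$ with values in $\mathbb R^3$ (smooth, with compact support in $\mathbb T^3\times[0,T)$). A *Leray–Hopf weak solution* is a weak solution that satisfies, for every $t\in[0,T]$, the energy inequality $$\tfrac12\|u(t)\|_{L^2}^2+\nu\int_0^t\|A^{s/2}u(\tau)\|_{L^2}^2\,d\tau\le\tfrac12\|u_0\|_{L^2}^2 .$$ A *strong solution* is a weak solution that belongs to $L^\infty((0,T);H^m(\mathbb T^3))\cap L^2((0,T);H^{m+s}(\mathbb T^3))$, where $m=1$ if $s>\frac56$, $m=2$ if $\frac13<s\le\frac56$, and $m=3$ if $0<s\le\frac13$. Let $u_S$ be a strong solution and $u_W$ a Leray–Hopf weak solution on $[0,T]$ with the same initial data $u_0$. Then $u_W\equiv u_S$ on $[0,T]$: $u_W(t)=u_S(t)$ in $L^2(\mathbb T^3)$ for almost every $t\in(0,T)$, and for every $t\in[0,T]$ if $u_W$ and $u_S$ are weakly continuous from $[0,T]$ to $L^2(\mathbb T^3)$. -/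

import Mathlib

open MeasureTheory Set
open scoped ENNReal NNReal

/-- The circle `ℝ / ℤ` carries its Haar measure of total mass `1`; this is the instance that
Mathlib's theory of multivariate Fourier series uses.  Hence the volume of the unit torus is the
normalised Haar measure. -/
noncomputable local instance FracNS.circleMeasureSpace : MeasureSpace UnitAddCircle :=
  ⟨AddCircle.haarAddCircle⟩

local instance FracNS.circleIsAddHaar :
    Measure.IsAddHaarMeasure (volume : Measure UnitAddCircle) :=
  inferInstanceAs (Measure.IsAddHaarMeasure AddCircle.haarAddCircle)

local instance FracNS.circleIsProbability :
    IsProbabilityMeasure (volume : Measure UnitAddCircle) :=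
  inferInstanceAs (IsProbabilityMeasure AddCircle.haarAddCircle)

noncomputable section

namespace FracNS

/-- The three-dimensional unit torus `𝕋³ = (ℝ / ℤ)³`. -/
abbrev Torus : Type := UnitAddTorus (Fin 3)

/-- The space of values of a velocity field. -/
abbrev Vec : Type := EuclideanSpace ℝ (Fin 3)

/-- The space `L²(𝕋³; ℝ³)`. -/
abbrev VecL2 : Type := Lp Vec 2 (volume : Measure Torus)

/-- The projection `ℝ³ → 𝕋³`. -/
def proj (x : Fin 3 → ℝ) : Torus := fun i => (x i : UnitAddCircle)

/-! ### Smooth functions on the torus -/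

/-- A function on the torus is smooth if its periodic lift to `ℝ³` is. -/
def SmoothOnTorus {F : Type*} [NormedAddCommGroup F] [NormedSpace ℝ F] (f : Torus → F) : Prop :=
  ContDiff ℝ (⊤ : ℕ∞) (fun x : Fin 3 → ℝ => f (proj x))

/-- The partial derivative `∂ⱼ f` of a real function on the torus. -/
def partialDeriv (j : Fin 3) (f : Torus → ℝ) (x : Torus) : ℝ :=
  deriv (fun h : ℝ => f (x + Pi.single j (h : UnitAddCircle))) 0

/-- Test functions in `𝒟(𝕋³ × [0, T))`: smooth vector fields (not necessarily divergence free)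
that vanish for times in a neighbourhood of `T` and later; they need not vanish at time `0`.
The values at negative times play no role. -/
structure IsTestFunction (T : ℝ) (ψ : ℝ → Torus → Vec) : Prop where
  smooth : ContDiff ℝ (⊤ : ℕ∞) (fun p : ℝ × (Fin 3 → ℝ) => ψ p.1 (proj p.2))
  support : ∃ T' < T, ∀ t, T' ≤ t → ∀ x, ψ t x = 0

/-! ### The fractional Laplacian and Sobolev spaces -/

/-- The Euclidean length of the wave vector `2πk`. -/
def waveNumber (k : Fin 3 → ℤ) : ℝ := 2 * Real.pi * Real.sqrt (∑ i, (k i : ℝ) ^ 2)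

/-- The `i`-th component of a vector field, as a complex-valued function. -/
def component (i : Fin 3) (f : Torus → Vec) (x : Torus) : ℂ := ((f x i : ℝ) : ℂ)

/-- The Fourier coefficient, at frequency `k`, of the `i`-th component of a vector field. -/
def coeff (i : Fin 3) (f : Torus → Vec) (k : Fin 3 → ℤ) : ℂ :=
  UnitAddTorus.mFourierCoeff (component i f) k

/-- The `i`-th component of `Aʳ f`, where `A = -Δ`, by the spectral representation
`Aʳ f = ∑ₖ |2πk|²ʳ f̂(k) exp(2πi k·x)`.  The series converges in `L²` exactly for `f ∈ H²ʳ`. -/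
def fracLap (r : ℝ) (i : Fin 3) (f : Torus → Vec) : Lp ℂ 2 (volume : Measure Torus) :=
  ∑' k : Fin 3 → ℤ, (((waveNumber k ^ (2 * r) : ℝ) : ℂ) * coeff i f k) •
    UnitAddTorus.mFourierLp 2 k

/-- `∫ (Aʳ f) · (Aʳ g) dx`: the sum over the components of the `L²` inner products (they are real,
because `f` and `g` are real). -/
def fracInner (r : ℝ) (f g : Torus → Vec) : ℝ :=
  ∑ i, (inner ℂ (fracLap r i f) (fracLap r i g)).re

/-- The squared norm of `Hʳ(𝕋³)`, `∑ₖ (1 + |2πk|²)ʳ |f̂(k)|²`, equal to `∞` off `Hʳ`. -/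
def sobolevNormSq (r : ℝ) (f : Torus → Vec) : ℝ≥0∞ :=
  ∑ i, ∑' k : Fin 3 → ℤ,
    ENNReal.ofReal ((1 + waveNumber k ^ 2) ^ r) * ‖coeff i f k‖ₑ ^ 2

/-- `u ∈ L^∞((0, T); Hʳ(𝕋³))`, for a strongly measurable `u : (0, T) → L²`. -/
def BoundedInSobolev (r T : ℝ) (u : ℝ → VecL2) : Prop :=
  ∃ C : ℝ≥0, ∀ᵐ t ∂(volume.restrict (Ioo 0 T)), sobolevNormSq r (u t) ≤ C

/-- `u ∈ L²((0, T); Hʳ(𝕋³))`, for a strongly measurable `u : (0, T) → L²`. -/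
def SqIntegrableInSobolev (r T : ℝ) (u : ℝ → VecL2) : Prop :=
  ∫⁻ t in Ioo 0 T, sobolevNormSq r (u t) < ∞

/-! ### Solutions -/

/-- `div f = 0` in the sense of distributions. -/
def DivFree (f : Torus → Vec) : Prop :=
  ∀ φ : Torus → ℝ, SmoothOnTorus φ → ∫ x, ∑ j, f x j * partialDeriv j φ x = 0

/-- The weak formulation
`∫₀ᵀ ∫ [u·∂ₜψ - ν A^{s/2}u · A^{s/2}ψ + u ⊗ u : ∇ψ + P div ψ] dx dt = - ∫ u₀·ψ(0) dx`
for all test functions `ψ ∈ 𝒟(𝕋³ × [0, T))`. -/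
def WeakFormulation (s ν T : ℝ) (u₀ : VecL2) (u : ℝ → VecL2)
    (P : ℝ → Lp ℝ 1 (volume : Measure Torus)) : Prop :=
  ∀ ψ : ℝ → Torus → Vec, IsTestFunction T ψ →
    ∫ t in (0 : ℝ)..T,
      ((∫ x, ∑ i, u t x i * deriv (fun τ => ψ τ x i) t)
        - ν * fracInner (s / 2) (u t) (ψ t)
        + (∫ x, ∑ i, ∑ j, u t x i * u t x j * partialDeriv j (fun y => ψ t y i) x)
        + ∫ x, P t x * ∑ j, partialDeriv j (fun y => ψ t y j) x)
      = - ∫ x, ∑ i, u₀ x i * ψ 0 x i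

/-- Weak solutions on `[0, T]` of
`∂ₜu + (u·∇)u + ν Aˢ u = -∇P`, `div u = 0`, with initial data `u₀`, in the energy class
`L^∞((0, T); L²) ∩ L²((0, T); Hˢ)`. -/
structure IsWeakSolution (s ν T : ℝ) (u₀ : VecL2) (u : ℝ → VecL2) : Prop where
  initial_divFree : DivFree u₀
  /-- `u ∈ L^∞((0, T); L²)`; this includes strong measurability. -/
  bounded : MemLp u (⊤ : ℝ≥0∞) (volume.restrict (Ioo 0 T))
  /-- `u ∈ L²((0, T); Hˢ)`. -/
  sqIntegrable : SqIntegrableInSobolev s T u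
  divFree : ∀ᵐ t ∂(volume.restrict (Ioo 0 T)), DivFree (u t)
  /-- There is a pressure `P ∈ L¹((0, T) × 𝕋³)` such that the equation holds weakly. -/
  equation : ∃ P : ℝ → Lp ℝ 1 (volume : Measure Torus),
    Integrable P (volume.restrict (Ioo 0 T)) ∧ WeakFormulation s ν T u₀ u P

/-- Leray–Hopf weak solutions: weak solutions that satisfy the energy inequality
`½ ‖u(t)‖² + ν ∫₀ᵗ ‖A^{s/2} u‖² dτ ≤ ½ ‖u₀‖²`. -/
structure IsLerayHopf (s ν T : ℝ) (u₀ : VecL2) (u : ℝ → VecL2) : Prop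
    extends IsWeakSolution s ν T u₀ u where
  energy : ∀ t ∈ Icc 0 T,
    1 / 2 * ‖u t‖ ^ 2 + ν * ∫ τ in (0 : ℝ)..t, fracInner (s / 2) (u τ) (u τ)
      ≤ 1 / 2 * ‖u₀‖ ^ 2

/-- The order of the Sobolev space in which strong solutions are bounded. -/
def strongOrder (s : ℝ) : ℝ :=
  if 5 / 6 < s then 1 else if 1 / 3 < s then 2 else 3

/-- Strong solutions: weak solutions of class `L^∞((0, T); Hᵐ) ∩ L²((0, T); Hᵐ⁺ˢ)`, where
`m = 1` for `s > 5/6`, `m = 2` for `1/3 < s ≤ 5/6`, and `m = 3` for `0 < s ≤ 1/3`. -/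
structure IsStrongSolution (s ν T : ℝ) (u₀ : VecL2) (u : ℝ → VecL2) : Prop
    extends IsWeakSolution s ν T u₀ u where
  strong_bounded : BoundedInSobolev (strongOrder s) T u
  strong_sqIntegrable : SqIntegrableInSobolev (strongOrder s + s) T u

/-- Weak continuity of `u : [0, T] → L²`. -/
def WeaklyContinuous (T : ℝ) (u : ℝ → VecL2) : Prop :=
  ∀ w : VecL2, ContinuousOn (fun t => inner ℝ (u t) w) (Icc 0 T)

end FracNS

end

noncomputable section

namespace FracNS

/-! Write `v` for the Leray–Hopf solution, `u` for the strong one, `w = v - u`, and `b(a, c, d) = ∫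
(a·∇c)·d`. Expanding `‖w‖² = ‖v‖² + ‖u‖² - 2⟪v, u⟫`, the energy inequality bounds the first term,
and an exact evolution identity gives the other two. Since `b(a, c, c) = 0` for divergence-free `a`,
this leaves `‖w(t)‖² ≤ ∫₀ᵗ (-2ν ‖A^{s/2} w‖² - 2 b(w, u, w))`. The cubic term satisfies `|b(w, u,
w)|² ≤ C ‖w‖² ‖u‖²_{H^{α+1}} ‖w‖²_{Hˢ}` as soon as `α + s > 3/2`. Young's inequality absorbs the
`Hˢ` norm of `w` into the dissipation, and Grönwall with the kernel `K ~ ‖u‖²_{H^{α+1}} + 1`,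
integrable in time, gives `w = 0`. The choice `α + 1 = m + s` is admissible
(`exists_strongOrder_eq`).

The delicate point is the identity for `⟪v, u⟫`, because neither solution may be used as a test
function. Everything is therefore done on Fourier coefficients. Testing with a scalar function of
time times a divergence-free trigonometric field removes the pressure and shows that each mode is a
primitive of a bounded function (`weak_integrand_eq`, `IsWeakSolution.ae_coeff_eq`). The product
rule applies to each mode (`ae_dotRe_eq`), and the modes are then summed
(`inner_eq_add_integral_crossRate`). The interchange of sum and integral needs absolute convergence
of the trilinear series, with all derivatives on `u`: this comes from the convolution estimate
`tsum_enorm_triTerm_sq_le` and the antisymmetry `triTerm_swap`, which holds term by term. The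
pointwise estimate for `w` is `rate_sub_le`; `ae_nonpos_of_le_integral_mul` is the Grönwall step. -/

/-- The lattice of frequencies of the torus. -/
abbrev Freq : Type := Fin 3 → ℤ

/-- Sequences of vector-valued Fourier coefficients. -/
abbrev VecSeq : Type := Freq → Fin 3 → ℂ

/-! ### Weighted sums over the lattice -/

/-- Cauchy–Schwarz, read off from Hölder's inequality for the counting measure. In `ℝ≥0∞` and in
squared form it needs neither summability nor square roots. -/
lemma sq_tsum_mul_le {ι : Type*} (f g : ι → ℝ≥0∞) :
    (∑' i, f i * g i) ^ 2 ≤ (∑' i, f i ^ 2) * ∑' i, g i ^ 2 := by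
  let _ : MeasurableSpace ι := ⊤
  have h := ENNReal.lintegral_mul_le_Lp_mul_Lq (Measure.count : Measure ι)
    Real.HolderConjugate.two_two (f := f) (g := g) (Measurable.of_discrete.aemeasurable)
    (Measurable.of_discrete.aemeasurable)
  simp only [lintegral_count, Pi.mul_apply, ENNReal.rpow_two] at h
  have h2 := pow_le_pow_left' h 2
  rw [mul_pow, ← ENNReal.rpow_two, ← ENNReal.rpow_two, ← ENNReal.rpow_two, ← ENNReal.rpow_mul,
    ← ENNReal.rpow_mul] at h2
  simpa using h2

/-- The weight `1 + |2πk|²` of the Sobolev norms. -/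
def weight (k : Freq) : ℝ := 1 + waveNumber k ^ 2

lemma one_le_weight (k : Freq) : 1 ≤ weight k := by
  unfold weight; nlinarith [sq_nonneg (waveNumber k)]

lemma weight_pos (k : Freq) : 0 < weight k := lt_of_lt_of_le one_pos (one_le_weight k)

lemma waveNumber_nonneg (k : Freq) : 0 ≤ waveNumber k := by unfold waveNumber; positivity

lemma waveNumber_neg (k : Freq) : waveNumber (-k) = waveNumber k := by
  unfold waveNumber; simp

lemma abs_le_waveNumber (k : Freq) (j : Fin 3) : 2 * Real.pi * |(k j : ℝ)| ≤ waveNumber k := by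
  unfold waveNumber
  gcongr
  apply Real.abs_le_sqrt
  exact Finset.single_le_sum (f := fun i => (k i : ℝ) ^ 2) (fun i _ => sq_nonneg _)
    (Finset.mem_univ j)

lemma summable_int_rpow {r : ℝ} (hr : 1 / 2 < r) :
    Summable fun n : ℤ => (1 + (n : ℝ) ^ 2) ^ (-r) := by
  have h : Summable fun n : ℤ => |(n : ℝ)| ^ (-(2 * r)) := by
    refine Real.summable_abs_int_rpow (by linarith)
  refine Summable.of_norm_bounded_eventually h ?_
  have : ∀ᶠ n : ℤ in Filter.cofinite, n ≠ 0 := by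
    exact (Set.finite_singleton (0 : ℤ)).subset fun x hx => by simpa using hx
  filter_upwards [this] with n hn
  have hn' : (0 : ℝ) < |(n : ℝ)| := by positivity
  rw [Real.norm_of_nonneg (by positivity)]
  have e : |(n : ℝ)| ^ (-(2 * r)) = ((n : ℝ) ^ 2) ^ (-r) := by
    rw [← sq_abs, ← Real.rpow_natCast, ← Real.rpow_mul hn'.le]; congr 1; push_cast; ring
  rw [e]
  apply Real.rpow_le_rpow_of_nonpos (by positivity) (by linarith) (by linarith)

/-- The weight dominates each `1 + kᵢ²`, so giving a third of the exponent to each coordinate bounds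
the sum by a product of three one-dimensional series. These converge because `r / 3 > 1/2`. -/
lemma tsum_weight_lt_top {r : ℝ} (hr : 3 / 2 < r) :
    ∑' k : Freq, ENNReal.ofReal (weight k ^ (-r)) < ∞ := by
  have hs : Summable fun n : ℤ => (1 + (n : ℝ) ^ 2) ^ (-(r / 3)) :=
    summable_int_rpow (by linarith)
  have key : ∀ k : Freq, weight k ^ (-r) ≤ ∏ i, (1 + (k i : ℝ) ^ 2) ^ (-(r / 3)) := by
    intro k
    have h1 : ∀ i, weight k ^ (-(r / 3)) ≤ (1 + (k i : ℝ) ^ 2) ^ (-(r / 3)) := by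
      intro i
      apply Real.rpow_le_rpow_of_nonpos (by positivity) _ (by linarith)
      have := abs_le_waveNumber k i
      have hpi := Real.pi_gt_three
      have h2 : |(k i : ℝ)| ≤ waveNumber k := by nlinarith [abs_nonneg (k i : ℝ)]
      unfold weight
      rw [← sq_abs (k i : ℝ)]
      gcongr
    have h3 : weight k ^ (-r) = ∏ _i : Fin 3, weight k ^ (-(r / 3)) := by
      rw [Finset.prod_const, Finset.card_univ, Fintype.card_fin, ← Real.rpow_natCast,
        ← Real.rpow_mul (weight_pos k).le]
      congr 1; push_cast; ring
    rw [h3]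
    exact Finset.prod_le_prod (fun i _ => Real.rpow_nonneg (weight_pos k).le _) fun i _ => h1 i
  have hs2 : Summable fun k : Freq => ∏ i, (1 + (k i : ℝ) ^ 2) ^ (-(r / 3)) := by
    refine summable_of_sum_le (c := ∏ _i : Fin 3, ∑' n : ℤ, (1 + (n : ℝ) ^ 2) ^ (-(r / 3)))
      (fun k => Finset.prod_nonneg fun i _ => by positivity) fun F => ?_
    calc ∑ k ∈ F, ∏ i, (1 + (k i : ℝ) ^ 2) ^ (-(r / 3))
        ≤ ∑ k ∈ Fintype.piFinset (fun i => F.image fun k : Freq => (k i : ℤ)),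
            ∏ i, (1 + ((k i : ℤ) : ℝ) ^ 2) ^ (-(r / 3)) := by
          apply Finset.sum_le_sum_of_subset_of_nonneg
          · intro k hk
            rw [Fintype.mem_piFinset]
            exact fun i => Finset.mem_image_of_mem _ hk
          · exact fun k _ _ => Finset.prod_nonneg fun i _ => by positivity
      _ = ∏ i, ∑ n ∈ F.image (fun k : Freq => (k i : ℤ)), (1 + (n : ℝ) ^ 2) ^ (-(r / 3)) :=
          (Finset.prod_univ_sum _ fun _ (n : ℤ) => (1 + (n : ℝ) ^ 2) ^ (-(r / 3))).symm
      _ ≤ _ := Finset.prod_le_prod (fun i _ => Finset.sum_nonneg fun n _ => by positivity)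
          fun i _ => hs.sum_le_tsum _ fun n _ => by positivity
  have hs3 : Summable fun k : Freq => weight k ^ (-r) :=
    Summable.of_nonneg_of_le (fun k => Real.rpow_nonneg (weight_pos k).le _) key hs2
  rw [← ENNReal.ofReal_tsum_of_nonneg (fun k => Real.rpow_nonneg (weight_pos k).le _) hs3]
  exact ENNReal.ofReal_lt_top

/-- The squared weighted norm of a sequence of magnitudes. -/
def weightedSq (r : ℝ) (x : Freq → ℝ≥0∞) : ℝ≥0∞ :=
  ∑' k, ENNReal.ofReal (weight k ^ r) * x k ^ 2

/-- The larger of the two weights, raised to a nonpositive power, may be replaced by the smaller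
one. This lets the smoothness `α + β` be split arbitrarily between two factors. -/
lemma weight_rpow_mul_le {α β : ℝ} (hα : 0 ≤ α) (hβ : 0 ≤ β) (q r : Freq) :
    ENNReal.ofReal (weight q ^ (-α)) * ENNReal.ofReal (weight r ^ (-β)) ≤
      ENNReal.ofReal (weight q ^ (-(α + β))) + ENNReal.ofReal (weight r ^ (-(α + β))) := by
  have hq := weight_pos q
  have hr := weight_pos r
  rw [← ENNReal.ofReal_mul (Real.rpow_nonneg hq.le _),
    ← ENNReal.ofReal_add (Real.rpow_nonneg hq.le _) (Real.rpow_nonneg hr.le _)]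
  apply ENNReal.ofReal_le_ofReal
  rw [neg_add, Real.rpow_add hq, Real.rpow_add hr]
  have h1 := Real.rpow_pos_of_pos hq (-α)
  have h2 := Real.rpow_pos_of_pos hr (-β)
  have h3 := Real.rpow_pos_of_pos hq (-β)
  have h4 := Real.rpow_pos_of_pos hr (-α)
  rcases le_total (weight q) (weight r) with h | h
  · have := Real.rpow_le_rpow_of_nonpos hq h (neg_nonpos.2 hβ)
    nlinarith
  · have := Real.rpow_le_rpow_of_nonpos hr h (neg_nonpos.2 hα)
    nlinarith

lemma ofReal_rpow_neg_mul_rpow (k : Freq) (r : ℝ) :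
    ENNReal.ofReal (weight k ^ (-r)) * ENNReal.ofReal (weight k ^ r) = 1 := by
  rw [← ENNReal.ofReal_mul (Real.rpow_nonneg (weight_pos k).le _), ← Real.rpow_add (weight_pos k)]
  simp

/-- The trilinear convolution estimate behind `L² × Hᵅ × Hᵝ → ℝ`, `α + β > 3/2`. -/
lemma sq_tsum_trilinear_le {α β : ℝ} (hα : 0 ≤ α) (hβ : 0 ≤ β) (x y z : Freq → ℝ≥0∞) :
    (∑' p, ∑' q, x p * (y q * z (p + q))) ^ 2 ≤
      2 * (∑' k : Freq, ENNReal.ofReal (weight k ^ (-(α + β)))) *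
        ((∑' p, x p ^ 2) * weightedSq α y * weightedSq β z) := by
  set Z := ∑' k : Freq, ENNReal.ofReal (weight k ^ (-(α + β))) with hZ
  have inner : ∀ p, (∑' q, y q * z (p + q)) ^ 2 ≤ 2 * Z *
      ∑' q, (ENNReal.ofReal (weight q ^ α) * y q ^ 2) *
        (ENNReal.ofReal (weight (p + q) ^ β) * z (p + q) ^ 2) := by
    intro p
    have hs : ∀ q : Freq, ∀ r : ℝ, (ENNReal.ofReal (weight q ^ (r / 2))) ^ 2 =
        ENNReal.ofReal (weight q ^ r) := by
      intro q r
      rw [← ENNReal.ofReal_pow (Real.rpow_nonneg (weight_pos q).le _), ← Real.rpow_natCast,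
        ← Real.rpow_mul (weight_pos q).le]
      congr 2; push_cast; ring
    -- Insert compensating powers of the weights at `q` and `p + q`: the negative powers form the
    -- first factor, which sums to at most `2 * Z`, and the positive ones build the Sobolev norms.
    have h1 := sq_tsum_mul_le
      (fun q => ENNReal.ofReal (weight q ^ (-α / 2)) * ENNReal.ofReal (weight (p + q) ^ (-β / 2)))
      (fun q => (ENNReal.ofReal (weight q ^ (α / 2)) * y q) *
        (ENNReal.ofReal (weight (p + q) ^ (β / 2)) * z (p + q)))
    have e : ∀ q, (ENNReal.ofReal (weight q ^ (-α / 2)) *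
        ENNReal.ofReal (weight (p + q) ^ (-β / 2))) *
        ((ENNReal.ofReal (weight q ^ (α / 2)) * y q) *
        (ENNReal.ofReal (weight (p + q) ^ (β / 2)) * z (p + q))) = y q * z (p + q) := by
      intro q
      have h2 := ofReal_rpow_neg_mul_rpow q (α / 2)
      have h3 := ofReal_rpow_neg_mul_rpow (p + q) (β / 2)
      rw [← neg_div] at h2 h3
      calc _ = (ENNReal.ofReal (weight q ^ (-α / 2)) * ENNReal.ofReal (weight q ^ (α / 2))) *
            (ENNReal.ofReal (weight (p + q) ^ (-β / 2)) *
              ENNReal.ofReal (weight (p + q) ^ (β / 2))) * (y q * z (p + q)) := by ring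
        _ = _ := by rw [h2, h3]; simp
    simp only [e, mul_pow, hs] at h1
    refine h1.trans ?_
    gcongr
    calc _ ≤ ∑' q, (ENNReal.ofReal (weight q ^ (-(α + β))) +
          ENNReal.ofReal (weight (p + q) ^ (-(α + β)))) :=
          ENNReal.tsum_le_tsum fun q => weight_rpow_mul_le hα hβ q (p + q)
      _ = Z + ∑' q, ENNReal.ofReal (weight (p + q) ^ (-(α + β))) := ENNReal.tsum_add
      _ = Z + Z := by
          congr 1
          exact (Equiv.addLeft p).tsum_eq fun k => ENNReal.ofReal (weight k ^ (-(α + β)))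
      _ = 2 * Z := (two_mul Z).symm
  simp only [ENNReal.tsum_mul_left]
  -- Cauchy–Schwarz in `p` isolates the `ℓ²` norm of `x`. Exchanging the sums over `p` and `q` and
  -- translating by `q` then decouples `y` from `z`.
  calc _ ≤ (∑' p, x p ^ 2) * ∑' p, (∑' q, y q * z (p + q)) ^ 2 := sq_tsum_mul_le _ _
    _ ≤ (∑' p, x p ^ 2) * ∑' p, 2 * Z *
      ∑' q, (ENNReal.ofReal (weight q ^ α) * y q ^ 2) *
        (ENNReal.ofReal (weight (p + q) ^ β) * z (p + q) ^ 2) := by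
        gcongr with p; exact inner p
    _ = (∑' p, x p ^ 2) * (2 * Z * (weightedSq α y * weightedSq β z)) := by
        congr 1
        rw [ENNReal.tsum_mul_left, ENNReal.tsum_comm]
        congr 1
        simp only [ENNReal.tsum_mul_left]
        have : ∀ q, ∑' p, (ENNReal.ofReal (weight (p + q) ^ β) * z (p + q) ^ 2) =
            weightedSq β z := fun q =>
          (Equiv.addRight q).tsum_eq fun k => ENNReal.ofReal (weight k ^ β) * z k ^ 2
        simp only [this, ENNReal.tsum_mul_right]
        rfl
    _ = _ := by ring

/-! ### The trilinear form -/

/-- The squared `Hʳ` norm of a sequence of Fourier coefficients. -/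
def seqNormSq (r : ℝ) (a : VecSeq) : ℝ≥0∞ :=
  ∑ i, ∑' k, ENNReal.ofReal ((1 + waveNumber k ^ 2) ^ r) * ‖a k i‖ₑ ^ 2

/-- The `ℓ¹` norm of the vector at a frequency. -/
def mag (a : VecSeq) (k : Freq) : ℝ≥0∞ := ∑ i, ‖a k i‖ₑ

lemma mag_sq_le (a : VecSeq) (k : Freq) : mag a k ^ 2 ≤ 3 * ∑ i, ‖a k i‖ₑ ^ 2 := by
  have := sq_tsum_mul_le (fun _ : Fin 3 => (1 : ℝ≥0∞)) (fun i => ‖a k i‖ₑ)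
  simpa [tsum_fintype, mag] using this

lemma weightedSq_mag_le (r : ℝ) (a : VecSeq) : weightedSq r (mag a) ≤ 3 * seqNormSq r a := by
  unfold weightedSq seqNormSq
  calc _ ≤ ∑' k, ENNReal.ofReal (weight k ^ r) * (3 * ∑ i, ‖a k i‖ₑ ^ 2) := by
        gcongr with k; exact mag_sq_le a k
    _ = 3 * ∑' k, ∑ i, ENNReal.ofReal (weight k ^ r) * ‖a k i‖ₑ ^ 2 := by
        rw [← ENNReal.tsum_mul_left]
        congr 1; ext k; rw [← Finset.mul_sum]; ring
    _ = _ := by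
        rw [Summable.tsum_finsetSum fun i _ => ENNReal.summable]; rfl

/-- The summand, at `(k, p)`, of the trilinear form `∫ (a·∇b)·c`. -/
def triTerm (a b c : VecSeq) (x : Freq × Freq) : ℂ :=
  (∑ j, a x.2 j * (2 * Real.pi * Complex.I * ((x.1 - x.2) j : ℤ))) *
    ∑ i, b (x.1 - x.2) i * (starRingEnd ℂ) (c x.1 i)

/-- The trilinear form `∫ (a·∇b)·c`. -/
def triForm (a b c : VecSeq) : ℂ := ∑' x, triTerm a b c x

lemma enorm_triTerm_le (a b c : VecSeq) (k p : Freq) :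
    ‖triTerm a b c (k, p)‖ₑ ≤
      mag a p * ((ENNReal.ofReal (waveNumber (k - p)) * mag b (k - p)) * mag c k) := by
  unfold triTerm
  rw [enorm_mul]
  have h1 : ‖∑ j, a p j * (2 * Real.pi * Complex.I * ((k - p) j : ℤ))‖ₑ ≤
      mag a p * ENNReal.ofReal (waveNumber (k - p)) := by
    refine (enorm_sum_le _ _).trans ?_
    rw [mag, Finset.sum_mul]
    gcongr with j
    rw [enorm_mul]
    gcongr
    rw [← ofReal_norm]
    apply ENNReal.ofReal_le_ofReal
    refine le_trans (le_of_eq ?_) (abs_le_waveNumber (k - p) j)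
    rw [norm_mul, norm_mul, norm_mul, Complex.norm_I, Complex.norm_real, Complex.norm_intCast,
      Real.norm_eq_abs, abs_of_pos Real.pi_pos]
    simp
  have h2 : ‖∑ i, b (k - p) i * (starRingEnd ℂ) (c k i)‖ₑ ≤ mag b (k - p) * mag c k := by
    refine (enorm_sum_le _ _).trans ?_
    simp only [mag]
    rw [Finset.sum_mul]
    gcongr with i
    rw [enorm_mul]
    gcongr
    rw [← ofReal_norm, RCLike.norm_conj, ofReal_norm]
    exact Finset.single_le_sum (f := fun i => ‖c k i‖ₑ) (fun _ _ => zero_le) (Finset.mem_univ i)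
  calc _ ≤ (mag a p * ENNReal.ofReal (waveNumber (k - p))) * (mag b (k - p) * mag c k) := by
        gcongr
    _ = _ := by ring

lemma weightedSq_waveNumber_mul_le (r : ℝ) (x : Freq → ℝ≥0∞) :
    weightedSq r (fun k => ENNReal.ofReal (waveNumber k) * x k) ≤ weightedSq (r + 1) x := by
  refine ENNReal.tsum_le_tsum fun k => ?_
  rw [mul_pow, ← mul_assoc, ← ENNReal.ofReal_pow (waveNumber_nonneg k),
    ← ENNReal.ofReal_mul (Real.rpow_nonneg (weight_pos k).le _), Real.rpow_add (weight_pos k),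
    Real.rpow_one]
  gcongr ENNReal.ofReal (_ * ?_) * _
  · exact Real.rpow_nonneg (weight_pos k).le _
  · unfold weight; linarith

/-- The constant of the trilinear estimate. -/
def triConst (ρ : ℝ) : ℝ≥0∞ := 54 * ∑' k : Freq, ENNReal.ofReal (weight k ^ (-ρ))

lemma triConst_lt_top {ρ : ℝ} (h : 3 / 2 < ρ) : triConst ρ < ∞ :=
  ENNReal.mul_lt_top (by simp) (tsum_weight_lt_top h)

/-- With `q = k - p` the series becomes the convolution form above. The derivative falls on `b` and
raises its order by one, while the transporting field `a` is measured in `L²` only. Bounding the sum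
of absolute values also yields convergence. -/
lemma tsum_enorm_triTerm_sq_le {α β : ℝ} (hα : 0 ≤ α) (hβ : 0 ≤ β) (a b c : VecSeq) :
    (∑' x, ‖triTerm a b c x‖ₑ) ^ 2 ≤
      triConst (α + β) * (seqNormSq 0 a * seqNormSq (α + 1) b * seqNormSq β c) := by
  have h1 : ∑' x, ‖triTerm a b c x‖ₑ ≤
      ∑' p, ∑' q, mag a p * ((ENNReal.ofReal (waveNumber q) * mag b q) * mag c (p + q)) := by
    rw [ENNReal.tsum_prod (f := fun k p => ‖triTerm a b c (k, p)‖ₑ), ENNReal.tsum_comm]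
    refine ENNReal.tsum_le_tsum fun p => ?_
    rw [← (Equiv.addLeft p).tsum_eq]
    refine ENNReal.tsum_le_tsum fun q => ?_
    refine (enorm_triTerm_le a b c _ p).trans ?_
    simp
  refine (pow_le_pow_left' h1 2).trans ((sq_tsum_trilinear_le hα hβ _ _ _).trans ?_)
  have h0 : ∑' p, mag a p ^ 2 ≤ 3 * seqNormSq 0 a := by
    refine le_trans (le_of_eq ?_) (weightedSq_mag_le 0 a)
    simp [weightedSq]
  -- The constant is `54 = 2 * 3 ^ 3`: each factor `3` compares the squared `ℓ¹` norm of a vector in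
  -- `ℂ³` with its squared `ℓ²` norm.
  calc _ ≤ 2 * (∑' k : Freq, ENNReal.ofReal (weight k ^ (-(α + β)))) *
        ((3 * seqNormSq 0 a) * (3 * seqNormSq (α + 1) b) * (3 * seqNormSq β c)) := by
        gcongr
        · exact (weightedSq_waveNumber_mul_le _ _).trans (weightedSq_mag_le _ _)
        · exact weightedSq_mag_le _ _
    _ = _ := by unfold triConst; ring

/-- Sequences of coefficients of real fields. -/
def IsRealSeq (a : VecSeq) : Prop := ∀ k i, a (-k) i = (starRingEnd ℂ) (a k i)

/-- Sequences of coefficients of divergence-free fields. -/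
def IsDivFreeSeq (a : VecSeq) : Prop := ∀ k, ∑ j, (k j : ℂ) * a k j = 0

/-- The involution `(k, p) ↦ (p - k, p)`. -/
def triSwap : Freq × Freq ≃ Freq × Freq where
  toFun x := (x.2 - x.1, x.2)
  invFun x := (x.2 - x.1, x.2)
  left_inv x := by simp
  right_inv x := by simp

/-- Integration by parts, term by term. By reality the involution preserves the product of the `b`
and `c` factors, and it replaces the frequency `k - p` by `-k`; the discrepancy is a multiple of
`p·a(p)`, which is zero. -/
lemma triTerm_swap {a b c : VecSeq} (ha : IsDivFreeSeq a) (hb : IsRealSeq b) (hc : IsRealSeq c)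
    (x : Freq × Freq) : triTerm a c b (triSwap x) = -triTerm a b c x := by
  obtain ⟨k, p⟩ := x
  unfold triTerm triSwap
  simp only [Equiv.coe_fn_mk]
  have e1 : p - k - p = -k := by abel
  have e2 : p - k = -(k - p) := by abel
  rw [e1, e2]
  simp only [hc k, hb (k - p), Complex.conj_conj]
  have h := ha p
  simp only [Fin.sum_univ_three, Pi.neg_apply, Pi.sub_apply, Int.cast_neg, Int.cast_sub] at h ⊢
  linear_combination (-2 * Real.pi * Complex.I * (b (k - p) 0 * (starRingEnd ℂ) (c k 0) +
    b (k - p) 1 * (starRingEnd ℂ) (c k 1) + b (k - p) 2 * (starRingEnd ℂ) (c k 2))) * h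

/-- No convergence is required: `tsum` commutes with reindexing and with negation unconditionally.
-/
lemma triForm_swap {a b c : VecSeq} (ha : IsDivFreeSeq a) (hb : IsRealSeq b) (hc : IsRealSeq c) :
    triForm a b c = -triForm a c b := by
  unfold triForm
  rw [← triSwap.tsum_eq, ← tsum_neg]
  exact tsum_congr fun x => triTerm_swap ha hc hb x

/-- This moves the derivative onto the regular field inside the absolute series. It is how the terms
of `(v·∇v)·u` are summed although `v` is only in the energy class. -/
lemma tsum_enorm_triTerm_swap {a b c : VecSeq} (ha : IsDivFreeSeq a) (hb : IsRealSeq b)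
    (hc : IsRealSeq c) : ∑' x, ‖triTerm a b c x‖ₑ = ∑' x, ‖triTerm a c b x‖ₑ := by
  rw [← triSwap.tsum_eq]
  exact tsum_congr fun x => by rw [triTerm_swap ha hc hb x, enorm_neg]

lemma triForm_self {a b : VecSeq} (ha : IsDivFreeSeq a) (hb : IsRealSeq b) :
    triForm a b b = 0 := by
  have := triForm_swap ha hb hb
  exact CharZero.eq_neg_self_iff.1 this

lemma summable_of_tsum_enorm_lt_top {ι : Type*} {f : ι → ℂ} (h : ∑' x, ‖f x‖ₑ < ∞) :
    Summable f := by
  refine Summable.of_norm ?_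
  have := ENNReal.summable_toReal h.ne
  simpa using this

/-- A crude form of the arithmetic–geometric mean inequality. It turns the squared trilinear bound
into a sum, both for integrability in time and for absorption into the dissipation. -/
lemma le_add_of_sq_le_mul {X P Q : ℝ≥0∞} (h : X ^ 2 ≤ P * Q) : X ≤ P + Q := by
  by_contra hlt
  push Not at hlt
  have h1 : P * Q ≤ (P + Q) ^ 2 := by
    rw [sq]; gcongr <;> simp
  have h2 : (P + Q) ^ 2 < X ^ 2 := by gcongr
  exact absurd (h.trans h1) (not_le.2 h2)

/-- The nonlinear terms of the equation for `⟪v, u⟫` in terms of the difference `v - u`. -/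
lemma triForm_sub {u v : VecSeq} (hu : IsDivFreeSeq u) (hv : IsDivFreeSeq v) (hur : IsRealSeq u)
    (hvu : ∑' x, ‖triTerm v u v x‖ₑ < ∞) (huv : ∑' x, ‖triTerm u u v x‖ₑ < ∞)
    (hvu' : ∑' x, ‖triTerm v u u x‖ₑ < ∞) (huu : ∑' x, ‖triTerm u u u x‖ₑ < ∞) :
    triForm v u v - triForm u u v = triForm (v - u) u (v - u) := by
  have h1 := summable_of_tsum_enorm_lt_top hvu
  have h2 := summable_of_tsum_enorm_lt_top huv
  have h3 := summable_of_tsum_enorm_lt_top hvu'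
  have h4 := summable_of_tsum_enorm_lt_top huu
  -- Bilinearity produces two extra terms, `b(v, u, u)` and `b(u, u, u)`, both zero by antisymmetry.
  have h0 : triForm v u u = 0 := triForm_self hv hur
  have h0' : triForm u u u = 0 := triForm_self hu hur
  have : triForm (v - u) u (v - u) =
      triForm v u v - triForm u u v - (triForm v u u - triForm u u u) := by
    unfold triForm
    rw [← h1.tsum_sub h2, ← h3.tsum_sub h4, ← (h1.sub h2).tsum_sub (h3.sub h4)]
    refine tsum_congr fun x => ?_
    simp only [triTerm, Pi.sub_apply, map_sub, Fin.sum_univ_three]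
    ring
  rw [this, h0, h0']; ring

/-! ### Primitives of integrable functions -/

lemma absolutelyContinuous_const_add_integral {f : ℝ → ℝ} {a b : ℝ}
    (hf : IntervalIntegrable f volume a b) (c : ℝ) :
    AbsolutelyContinuousOnInterval (fun x => c + ∫ y in a..x, f y) a b := by
  have h1 : AbsolutelyContinuousOnInterval (fun _ : ℝ => c) a b :=
    LipschitzOnWith.absolutelyContinuousOnInterval (K := 0) (LipschitzWith.const c).lipschitzOnWith
  exact h1.add (hf.absolutelyContinuousOnInterval_intervalIntegral left_mem_uIcc)

lemma ae_deriv_const_add_integral {f : ℝ → ℝ} {a b : ℝ}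
    (hf : IntervalIntegrable f volume a b) (c : ℝ) :
    ∀ᵐ x, x ∈ uIcc a b → deriv (fun x => c + ∫ y in a..x, f y) x = f x := by
  filter_upwards [hf.ae_hasDerivAt_integral] with x hx hxm
  exact ((hx hxm a left_mem_uIcc).const_add c).deriv

/-- Integration by parts for absolutely continuous functions: `f` and `g` are merely integrable, so
the derivatives of the primitives are identified almost everywhere. -/
lemma const_add_integral_mul {f g : ℝ → ℝ} {a b : ℝ}
    (hf : IntervalIntegrable f volume a b) (hg : IntervalIntegrable g volume a b) (c d : ℝ) :
    (c + ∫ y in a..b, f y) * (d + ∫ y in a..b, g y) =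
      c * d + ∫ x in a..b, (f x * (d + ∫ y in a..x, g y) + (c + ∫ y in a..x, f y) * g x) := by
  have h := (absolutelyContinuous_const_add_integral hf c).integral_deriv_mul_eq_sub
    (absolutelyContinuous_const_add_integral hg d)
  have h2 : ∫ x in a..b, (f x * (d + ∫ y in a..x, g y) + (c + ∫ y in a..x, f y) * g x) =
      ∫ x in a..b, deriv (fun x => c + ∫ y in a..x, f y) x * (d + ∫ y in a..x, g y) +
        (c + ∫ y in a..x, f y) * deriv (fun x => d + ∫ y in a..x, g y) x := by
    apply intervalIntegral.integral_congr_ae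
    filter_upwards [ae_deriv_const_add_integral hf c, ae_deriv_const_add_integral hg d]
      with x h1 h2 hx
    rw [h1 (uIoc_subset_uIcc hx), h2 (uIoc_subset_uIcc hx)]
  rw [h2, h]
  simp

lemma continuousOn_const_add_integral {f : ℝ → ℝ} {a b : ℝ}
    (hf : IntervalIntegrable f volume a b) (c : ℝ) :
    ContinuousOn (fun x => c + ∫ y in a..x, f y) (uIcc a b) :=
  (absolutelyContinuous_const_add_integral hf c).continuousOn

lemma intervalIntegrable_re {f : ℝ → ℂ} {a b : ℝ} (hf : IntervalIntegrable f volume a b) :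
    IntervalIntegrable (fun x => (f x).re) volume a b :=
  ⟨hf.1.re, hf.2.re⟩

lemma intervalIntegrable_im {f : ℝ → ℂ} {a b : ℝ} (hf : IntervalIntegrable f volume a b) :
    IntervalIntegrable (fun x => (f x).im) volume a b :=
  ⟨hf.1.im, hf.2.im⟩

lemma re_integral {f : ℝ → ℂ} {a b : ℝ} (hf : IntervalIntegrable f volume a b) :
    (∫ x in a..b, f x).re = ∫ x in a..b, (f x).re :=
  (Complex.reCLM.intervalIntegral_comp_comm hf).symm

lemma im_integral {f : ℝ → ℂ} {a b : ℝ} (hf : IntervalIntegrable f volume a b) :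
    (∫ x in a..b, f x).im = ∫ x in a..b, (f x).im :=
  (Complex.imCLM.intervalIntegral_comp_comm hf).symm

/-- The product rule for the Hermitian product of two complex primitives. -/
lemma re_const_add_integral_mul_conj {f g : ℝ → ℂ} {a b : ℝ}
    (hf : IntervalIntegrable f volume a b) (hg : IntervalIntegrable g volume a b) (c d : ℂ) :
    ((c + ∫ y in a..b, f y) * (starRingEnd ℂ) (d + ∫ y in a..b, g y)).re =
      (c * (starRingEnd ℂ) d).re +
      ∫ x in a..b, (f x * (starRingEnd ℂ) (d + ∫ y in a..x, g y) +
        (c + ∫ y in a..x, f y) * (starRingEnd ℂ) (g x)).re := by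
  have h1 := const_add_integral_mul (intervalIntegrable_re hf) (intervalIntegrable_re hg) c.re d.re
  have h2 := const_add_integral_mul (intervalIntegrable_im hf) (intervalIntegrable_im hg) c.im d.im
  have i1 : ∀ {p q : ℝ → ℝ} (_ : IntervalIntegrable p volume a b)
      (_ : IntervalIntegrable q volume a b) (c d : ℝ), IntervalIntegrable (fun x =>
        p x * (d + ∫ y in a..x, q y) + (c + ∫ y in a..x, p y) * q x) volume a b :=
    fun hp hq c d => (hp.mul_continuousOn (continuousOn_const_add_integral hq d)).add
      (hq.continuousOn_mul (continuousOn_const_add_integral hp c))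
  simp only [Complex.mul_re, Complex.conj_re, Complex.conj_im, Complex.add_re, Complex.add_im,
    re_integral hf, re_integral hg, im_integral hf, im_integral hg]
  have h3 : ∫ x in a..b, ((f x).re * (d.re + (∫ y in a..x, g y).re) -
        (f x).im * -(d.im + (∫ y in a..x, g y).im) +
        ((c.re + (∫ y in a..x, f y).re) * (g x).re -
          (c.im + (∫ y in a..x, f y).im) * -(g x).im)) =
      (∫ x in a..b, ((f x).re * (d.re + ∫ y in a..x, (g y).re) +
        (c.re + ∫ y in a..x, (f y).re) * (g x).re)) +
      ∫ x in a..b, ((f x).im * (d.im + ∫ y in a..x, (g y).im) +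
        (c.im + ∫ y in a..x, (f y).im) * (g x).im) := by
    rw [← intervalIntegral.integral_add
      (i1 (intervalIntegrable_re hf) (intervalIntegrable_re hg) c.re d.re)
      (i1 (intervalIntegrable_im hf) (intervalIntegrable_im hg) c.im d.im)]
    refine intervalIntegral.integral_congr fun x hx => ?_
    have hf' : IntervalIntegrable f volume a x := hf.mono_set (uIcc_subset_uIcc_left hx)
    have hg' : IntervalIntegrable g volume a x := hg.mono_set (uIcc_subset_uIcc_left hx)
    simp only [re_integral hf', re_integral hg', im_integral hf', im_integral hg']
    ring
  rw [h3]
  linarith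

/-! ### The lemma of du Bois-Reymond -/

/-- The primitive starts from `T`, so that it vanishes near `T`. It need not vanish at `0`, and this
is how the initial value is detected. -/
lemma exists_contDiff_primitive {T : ℝ} {θ : ℝ → ℝ} (hθ : ContDiff ℝ (⊤ : ℕ∞) θ)
    (hc : HasCompactSupport θ) (hsupp : tsupport θ ⊆ Ioo 0 T) :
    ∃ φ : ℝ → ℝ, ContDiff ℝ (⊤ : ℕ∞) φ ∧ (∃ T' < T, ∀ t, T' ≤ t → φ t = 0) ∧ deriv φ = θ := by
  have hd : ∀ t, HasDerivAt (fun t => ∫ y in T..t, θ y) (θ t) t := fun t =>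
    hθ.continuous.integral_hasStrictDerivAt T t |>.hasDerivAt
  have hderiv : deriv (fun t => ∫ y in T..t, θ y) = θ := funext fun t => (hd t).deriv
  refine ⟨fun t => ∫ y in T..t, θ y, ?_, ?_, hderiv⟩
  · rw [contDiff_infty_iff_deriv, hderiv]
    exact ⟨fun t => (hd t).differentiableAt, hθ⟩
  · have hT : T ∉ tsupport θ := fun h => lt_irrefl _ (hsupp h).2
    have hn : (tsupport θ)ᶜ ∈ nhds T := hc.isCompact.isClosed.isOpen_compl.mem_nhds hT
    obtain ⟨ε, hε, hball⟩ := Metric.mem_nhds_iff.1 hn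
    have hz : ∀ t, T - ε / 2 ≤ t → θ t = 0 := by
      intro t ht
      by_contra hne
      have hmem : t ∈ tsupport θ := subset_tsupport _ hne
      have := (hsupp hmem).2
      refine hball ?_ hmem
      rw [Metric.mem_ball, Real.dist_eq, abs_lt]
      constructor <;> linarith
    refine ⟨T - ε / 2, by linarith, fun t ht => ?_⟩
    refine intervalIntegral.integral_zero_ae (Filter.Eventually.of_forall fun y hy => hz y ?_)
    have : min T t < y := hy.1
    rcases le_total T t with h | h
    · rw [min_eq_left h] at this; linarith
    · rw [min_eq_right h] at this; linarith

/-- If `f' = h` on `[0, T)` in the weak sense, with initial value `c`, then `f` is a primitive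
of `h`. -/
lemma ae_eq_primitive_of_weak_deriv {T : ℝ} (hT : 0 < T) {f h : ℝ → ℝ} {c : ℝ}
    (hf : IntegrableOn f (Ioo 0 T)) (hh : IntegrableOn h (Ioo 0 T))
    (H : ∀ φ : ℝ → ℝ, ContDiff ℝ (⊤ : ℕ∞) φ → (∃ T' < T, ∀ t, T' ≤ t → φ t = 0) →
      ∫ t in (0 : ℝ)..T, (deriv φ t * f t + φ t * h t) = -(φ 0 * c)) :
    ∀ᵐ t ∂(volume.restrict (Ioo 0 T)), f t = c + ∫ y in (0 : ℝ)..t, h y := by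
  have hfi : IntervalIntegrable f volume 0 T :=
    (intervalIntegrable_iff_integrableOn_Ioo_of_le hT.le).2 hf
  have hhi : IntervalIntegrable h volume 0 T :=
    (intervalIntegrable_iff_integrableOn_Ioo_of_le hT.le).2 hh
  have hcont := continuousOn_const_add_integral hhi c
  have hPi : IntervalIntegrable (fun t => c + ∫ y in (0 : ℝ)..t, h y) volume 0 T :=
    hcont.intervalIntegrable
  have key : ∀ᵐ t, t ∈ Ioo 0 T → f t - (c + ∫ y in (0 : ℝ)..t, h y) = 0 := by
    refine isOpen_Ioo.ae_eq_zero_of_integral_contDiff_smul_eq_zero ?_ ?_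
    · exact IntegrableOn.locallyIntegrableOn
        ((intervalIntegrable_iff_integrableOn_Ioo_of_le hT.le).1 (hfi.sub hPi))
    · intro θ hθ hc hsupp
      -- Given any bump `θ`, test with its primitive `φ`. The candidate `c + ∫ h` satisfies the same
      -- weak identity by parts, and subtracting leaves `∫ θ (f - c - ∫ h) = 0`.
      obtain ⟨φ, hφ, ⟨T', hT', hz⟩, hd⟩ := exists_contDiff_primitive hθ hc hsupp
      have h1 := H φ hφ ⟨T', hT', hz⟩
      have hθi : IntervalIntegrable θ volume 0 T := hθ.continuous.intervalIntegrable _ _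
      have hφe : ∀ t, φ t = φ 0 + ∫ y in (0 : ℝ)..t, θ y := by
        intro t
        rw [← hd, intervalIntegral.integral_deriv_eq_sub]
        · ring
        · exact fun x _ => (hφ.differentiable (by simp)).differentiableAt
        · rw [hd]; exact hθ.continuous.intervalIntegrable _ _
      have h2 := const_add_integral_mul hθi hhi (φ 0) c
      rw [← hφe T, hz T hT'.le, zero_mul] at h2
      simp only [← hφe, hd] at h1 h2
      have j1 : IntervalIntegrable (fun t => θ t * f t + φ t * h t) volume 0 T :=
        (hfi.continuousOn_mul hθ.continuous.continuousOn).add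
          (hhi.continuousOn_mul hφ.continuous.continuousOn)
      have j2 : IntervalIntegrable (fun t => θ t * (c + ∫ y in (0 : ℝ)..t, h y) + φ t * h t)
          volume 0 T :=
        (hPi.continuousOn_mul hθ.continuous.continuousOn).add
          (hhi.continuousOn_mul hφ.continuous.continuousOn)
      have h3 : ∫ t in (0 : ℝ)..T, θ t * (f t - (c + ∫ y in (0 : ℝ)..t, h y)) = 0 := by
        have := intervalIntegral.integral_sub j1 j2
        rw [h1] at this
        calc _ = ∫ t in (0 : ℝ)..T, ((θ t * f t + φ t * h t) -
              (θ t * (c + ∫ y in (0 : ℝ)..t, h y) + φ t * h t)) := by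
              congr 1; ext t; ring
          _ = 0 := by rw [this]; linarith
      rw [intervalIntegral.integral_of_le hT.le, integral_Ioc_eq_integral_Ioo] at h3
      rw [setIntegral_eq_integral_of_forall_compl_eq_zero fun x hx => by
        rw [image_eq_zero_of_notMem_tsupport fun hm => hx (hsupp hm), zero_mul]] at h3
      simpa only [smul_eq_mul] using h3
  rw [ae_restrict_iff' measurableSet_Ioo]
  filter_upwards [key] with t ht hm
  linarith [ht hm]

/-! ### A Grönwall lemma with an integrable kernel -/

/-- A continuation argument instead of an integrating factor. The function `ψ(t) = ∫₀ᵗ K f` is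
continuous, nondecreasing and zero at `0`; from a zero `x`, any `z > x` with `∫ₓᶻ K < 1/2` satisfies
`ψ z ≤ ψ z / 2`, so the zero set propagates to all of `[0, T]`. -/
lemma ae_nonpos_of_le_integral_mul {T : ℝ} (hT : 0 < T) {f K : ℝ → ℝ}
    (hK : IntegrableOn K (Ioo 0 T)) (hKf : IntegrableOn (fun t => K t * f t) (Ioo 0 T))
    (hK0 : ∀ t, 0 ≤ K t) (hf0 : ∀ t, 0 ≤ f t)
    (H : ∀ᵐ t ∂(volume.restrict (Ioo 0 T)), f t ≤ ∫ y in (0 : ℝ)..t, K y * f y) :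
    ∀ᵐ t ∂(volume.restrict (Ioo 0 T)), f t ≤ 0 := by
  have hKi : IntervalIntegrable K volume 0 T :=
    (intervalIntegrable_iff_integrableOn_Ioo_of_le hT.le).2 hK
  have hKfi : IntervalIntegrable (fun t => K t * f t) volume 0 T :=
    (intervalIntegrable_iff_integrableOn_Ioo_of_le hT.le).2 hKf
  have sub : ∀ {p : ℝ → ℝ}, IntervalIntegrable p volume 0 T → ∀ x ∈ Icc 0 T, ∀ z ∈ Icc 0 T,
      IntervalIntegrable p volume x z := fun hp x hx z hz =>
    hp.mono_set (by rw [uIcc_of_le hT.le]; exact (uIcc_subset_Icc hx hz))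
  set ψ : ℝ → ℝ := fun t => ∫ y in (0 : ℝ)..t, K y * f y with hψ
  have hψc : ContinuousOn ψ (Icc 0 T) := by
    have := continuousOn_const_add_integral hKfi 0
    simpa [uIcc_of_le hT.le] using this
  have hκc : ContinuousOn (fun t => ∫ y in (0 : ℝ)..t, K y) (Icc 0 T) := by
    have := continuousOn_const_add_integral hKi 0
    simpa [uIcc_of_le hT.le] using this
  have h0T : (0 : ℝ) ∈ Icc 0 T := ⟨le_rfl, hT.le⟩
  have hmono : ∀ x ∈ Icc 0 T, ∀ z ∈ Icc 0 T, x ≤ z → ψ x ≤ ψ z := by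
    intro x hx z hz hxz
    have := intervalIntegral.integral_add_adjacent_intervals (sub hKfi 0 h0T x hx)
      (sub hKfi x hx z hz)
    have h2 : 0 ≤ ∫ y in x..z, K y * f y :=
      intervalIntegral.integral_nonneg hxz fun y _ => mul_nonneg (hK0 y) (hf0 y)
    simp only [hψ]; linarith
  have hψ0 : ψ 0 = 0 := by simp [hψ]
  have main : Icc 0 T ⊆ {t | ψ t = 0} := by
    refine IsClosed.Icc_subset_of_forall_exists_gt ?_ hψ0 ?_
    · rw [inter_comm]
      exact hψc.preimage_isClosed_of_isClosed isClosed_Icc (isClosed_singleton (x := (0 : ℝ)))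
    · rintro x ⟨hx0, hx⟩ y hy
      have hxI : x ∈ Icc 0 T := ⟨hx.1, hx.2.le⟩
      have hκx := hκc x hxI
      have hev : ∀ᶠ z in nhdsWithin x (Icc 0 T),
          (∫ y in (0 : ℝ)..z, K y) < (∫ y in (0 : ℝ)..x, K y) + 1 / 2 :=
        hκx.eventually_lt_const (by linarith)
      have hle : nhdsWithin x (Ioi x) ≤ nhdsWithin x (Icc 0 T) := by
        rw [← nhdsWithin_Ioc_eq_nhdsGT hx.2]
        exact nhdsWithin_mono _ fun z hz => ⟨hx.1.trans hz.1.le, hz.2⟩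
      have hlt : ∀ᶠ z in nhdsWithin x (Ioi x), z ∈ Ioc x (min y T) :=
        Ioc_mem_nhdsGT (lt_min hy hx.2)
      obtain ⟨z, hz1, hz2⟩ := ((hev.filter_mono hle).and hlt).exists
      have hzI : z ∈ Icc 0 T := ⟨hx.1.trans hz2.1.le, hz2.2.trans (min_le_right _ _)⟩
      refine ⟨z, ?_, hz2.1, hz2.2.trans (min_le_left _ _)⟩
      have a1 := intervalIntegral.integral_add_adjacent_intervals (sub hKi 0 h0T x hxI)
        (sub hKi x hxI z hzI)
      have a2 := intervalIntegral.integral_add_adjacent_intervals (sub hKfi 0 h0T x hxI)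
        (sub hKfi x hxI z hzI)
      -- On `[x, z]`, `f ≤ ψ ≤ ψ z` almost everywhere, by the hypothesis and monotonicity.
      have a3 : ∫ y in x..z, K y * f y ≤ ∫ y in x..z, K y * ψ z := by
        refine intervalIntegral.integral_mono_ae_restrict hz2.1.le (sub hKfi x hxI z hzI)
          ((sub hKi x hxI z hzI).mul_const _) ?_
        have H' := (ae_restrict_iff' measurableSet_Ioo).1 H
        have hT' : ∀ᵐ t : ℝ, t ≠ T := by simp [ae_iff]
        have h0' : ∀ᵐ t : ℝ, t ≠ 0 := by simp [ae_iff]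
        refine (ae_restrict_iff' measurableSet_Icc).2 ?_
        filter_upwards [H', hT', h0'] with t ht htT ht0 hm
        have htI : t ∈ Icc 0 T := ⟨hx.1.trans hm.1, hm.2.trans hzI.2⟩
        have := ht ⟨lt_of_le_of_ne htI.1 (Ne.symm ht0), lt_of_le_of_ne htI.2 htT⟩
        exact mul_le_mul_of_nonneg_left (this.trans (hmono t htI z hzI hm.2)) (hK0 t)
      rw [intervalIntegral.integral_mul_const] at a3
      have hx0' : (∫ y in (0 : ℝ)..x, K y * f y) = 0 := hx0
      have hz0 : 0 ≤ ψ z := by rw [← hψ0]; exact hmono 0 h0T z hzI hzI.1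
      have e : ψ z = ∫ y in x..z, K y * f y := by simp only [hψ]; linarith
      have : (∫ y in x..z, K y) * ψ z ≤ 1 / 2 * ψ z :=
        mul_le_mul_of_nonneg_right (by linarith) hz0
      show ψ z = 0
      linarith
  filter_upwards [H, ae_restrict_mem measurableSet_Ioo] with t ht hm
  exact ht.trans (le_of_eq (main ⟨hm.1.le, hm.2.le⟩))

open UnitAddTorus

/-! ### Fourier coefficients of square-integrable functions -/

lemma mFourierCoeff_congr_ae {F G : Torus → ℂ} (h : F =ᵐ[volume] G) (k : Freq) :
    mFourierCoeff F k = mFourierCoeff G k := by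
  unfold mFourierCoeff
  apply integral_congr_ae
  filter_upwards [h] with x hx
  rw [hx]

lemma hasSum_conj_mFourierCoeff_mul {F G : Torus → ℂ} (hF : MemLp F 2) (hG : MemLp G 2) :
    HasSum (fun k => (starRingEnd ℂ) (mFourierCoeff F k) * mFourierCoeff G k)
      (∫ x, (starRingEnd ℂ) (F x) * G x) := by
  have h := hasSum_prod_mFourierCoeff (hF.toLp F) (hG.toLp G)
  simp only [mFourierCoeff_congr_ae hF.coeFn_toLp, mFourierCoeff_congr_ae hG.coeFn_toLp] at h
  convert! h using 1
  apply integral_congr_ae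
  filter_upwards [hF.coeFn_toLp, hG.coeFn_toLp] with x h1 h2
  rw [h1, h2]

lemma memLp_apply {f : Torus → Vec} (hf : MemLp f 2) (i : Fin 3) : MemLp (fun x => f x i) 2 :=
  (EuclideanSpace.proj (𝕜 := ℝ) i : Vec →L[ℝ] ℝ).comp_memLp' hf

lemma memLp_component {f : Torus → Vec} (hf : MemLp f 2) (i : Fin 3) :
    MemLp (component i f) 2 := (memLp_apply hf i).ofReal

lemma memLp_mFourier_mul {F : Torus → ℂ} (hF : MemLp F 2) (k : Freq) :
    MemLp (fun x => mFourier k x * F x) 2 := by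
  refine hF.of_le ((mFourier k).continuous.aestronglyMeasurable.mul hF.1) ?_
  filter_upwards with x
  rw [norm_mul]
  have : ‖mFourier k x‖ ≤ 1 := ((mFourier k).norm_coe_le_norm x).trans_eq mFourier_norm
  exact mul_le_of_le_one_left (norm_nonneg _) this

lemma mFourierCoeff_mFourier_mul (F : Torus → ℂ) (k m : Freq) :
    mFourierCoeff (fun x => mFourier k x * F x) m = mFourierCoeff F (m - k) := by
  unfold mFourierCoeff
  congr 1; ext x
  rw [smul_eq_mul, smul_eq_mul, ← mul_assoc, ← mFourier_add, neg_sub, neg_add_eq_sub]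

lemma coeff_neg (f : Torus → Vec) (k : Freq) (i : Fin 3) :
    coeff i f (-k) = (starRingEnd ℂ) (coeff i f k) := by
  unfold coeff mFourierCoeff
  rw [← integral_conj]
  congr 1; ext x
  simp only [smul_eq_mul, map_mul, component, Complex.conj_ofReal]
  rw [← mFourier_neg]

/-- The Fourier coefficients of a vector field. -/
def coeffSeq (f : Torus → Vec) : VecSeq := fun k i => coeff i f k

lemma isRealSeq_coeffSeq (f : Torus → Vec) : IsRealSeq (coeffSeq f) := fun k i => coeff_neg f k i

/-- The Fourier coefficients of the components of `f ⊗ g`. -/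
def coeffMul (f g : Torus → Vec) (i j : Fin 3) (k : Freq) : ℂ :=
  mFourierCoeff (fun x => component i f x * component j g x) k

/-- The product of two `L²` functions is only in `L¹`, but its coefficient at `k` is the `L²`
pairing of `mFourier k * fᵢ` with `gⱼ`. Parseval turns this into a convolution, using that `f` is
real. -/
lemma hasSum_coeffMul {f g : Torus → Vec} (hf : MemLp f 2) (hg : MemLp g 2) (i j : Fin 3)
    (k : Freq) :
    HasSum (fun p => coeff j g p * coeff i f (k - p)) (coeffMul f g i j k) := by
  have h := hasSum_conj_mFourierCoeff_mul (memLp_mFourier_mul (memLp_component hf i) k)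
    (memLp_component hg j)
  simp only [mFourierCoeff_mFourier_mul] at h
  have e : (∫ x, (starRingEnd ℂ) (mFourier k x * component i f x) * component j g x) =
      coeffMul f g i j k := by
    unfold coeffMul mFourierCoeff
    congr 1; ext x
    rw [map_mul, ← mFourier_neg, smul_eq_mul, mul_assoc]
    simp [component]
  rw [e] at h
  refine h.congr_fun fun p => ?_
  have := coeff_neg f (p - k) i
  rw [neg_sub] at this
  rw [this, mul_comm]; rfl

lemma hasSum_coeff_inner {f g : Torus → Vec} (hf : MemLp f 2) (hg : MemLp g 2) (i : Fin 3) :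
    HasSum (fun k => (coeff i f k * (starRingEnd ℂ) (coeff i g k)).re) (∫ x, f x i * g x i) := by
  have h := hasSum_conj_mFourierCoeff_mul (memLp_component hg i) (memLp_component hf i)
  have h2 := Complex.hasSum_re h
  have e : (∫ x, (starRingEnd ℂ) (component i g x) * component i f x).re =
      ∫ x, f x i * g x i := by
    have : ∀ x, (starRingEnd ℂ) (component i g x) * component i f x = ((f x i * g x i : ℝ) : ℂ) := by
      intro x; simp [component, mul_comm]
    simp only [this]
    rw [integral_complex_ofReal, Complex.ofReal_re]
  rw [e] at h2
  refine h2.congr_fun fun k => ?_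
  rw [mul_comm]; rfl

lemma integrable_apply_mul_apply {f g : Torus → Vec} (hf : MemLp f 2) (hg : MemLp g 2)
    (i j : Fin 3) : Integrable (fun x => f x i * g x j) :=
  (memLp_apply hf i).integrable_mul (memLp_apply hg j)

/-- The Hermitian product of the coefficients at one frequency (real part). -/
def dotRe (a b : VecSeq) (k : Freq) : ℝ := ∑ i, (a k i * (starRingEnd ℂ) (b k i)).re

lemma hasSum_dotRe {f g : Torus → Vec} (hf : MemLp f 2) (hg : MemLp g 2) :
    HasSum (dotRe (coeffSeq f) (coeffSeq g)) (∫ x, ∑ i, f x i * g x i) := by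
  rw [integral_finsetSum _ fun i _ => integrable_apply_mul_apply hf hg i i]
  exact hasSum_sum fun i _ => hasSum_coeff_inner hf hg i

lemma inner_eq_integral (f g : VecL2) : inner ℝ f g = ∫ x, ∑ i, f x i * g x i := by
  rw [L2.inner_def]
  congr 1; ext x
  rw [PiLp.inner_apply]
  refine Finset.sum_congr rfl fun i _ => ?_
  simp [mul_comm]

lemma hasSum_dotRe_inner (f g : VecL2) :
    HasSum (dotRe (coeffSeq f) (coeffSeq g)) (inner ℝ f g) := by
  rw [inner_eq_integral]
  exact hasSum_dotRe (Lp.memLp f) (Lp.memLp g)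

lemma dotRe_self (a : VecSeq) (k : Freq) : dotRe a a k = ∑ i, ‖a k i‖ ^ 2 := by
  unfold dotRe
  refine Finset.sum_congr rfl fun i _ => ?_
  rw [Complex.mul_conj, Complex.ofReal_re, Complex.normSq_eq_norm_sq]

lemma seqNormSq_eq_tsum_dotRe (r : ℝ) (a : VecSeq) :
    seqNormSq r a = ∑' k, ENNReal.ofReal (weight k ^ r * dotRe a a k) := by
  unfold seqNormSq
  rw [← Summable.tsum_finsetSum fun i _ => ENNReal.summable]
  refine tsum_congr fun k => ?_
  rw [dotRe_self, ENNReal.ofReal_mul (Real.rpow_nonneg (weight_pos k).le _),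
    ENNReal.ofReal_sum_of_nonneg fun i _ => sq_nonneg _, Finset.mul_sum]
  refine Finset.sum_congr rfl fun i _ => ?_
  rw [ENNReal.ofReal_pow (norm_nonneg _), ofReal_norm]
  rfl

lemma dotRe_self_nonneg (a : VecSeq) (k : Freq) : 0 ≤ dotRe a a k := by
  rw [dotRe_self]; positivity

lemma seqNormSq_zero_coeffSeq {f : Torus → Vec} (hf : MemLp f 2) :
    seqNormSq 0 (coeffSeq f) = ENNReal.ofReal (∫ x, ∑ i, f x i * f x i) := by
  rw [seqNormSq_eq_tsum_dotRe, ← (hasSum_dotRe hf hf).tsum_eq,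
    ENNReal.ofReal_tsum_of_nonneg (dotRe_self_nonneg _) (hasSum_dotRe hf hf).summable]
  simp

lemma seqNormSq_zero_eq (f : VecL2) : seqNormSq 0 (coeffSeq f) = ENNReal.ofReal (‖f‖ ^ 2) := by
  rw [seqNormSq_zero_coeffSeq (Lp.memLp f), ← inner_eq_integral, real_inner_self_eq_norm_sq]

lemma coeffSeq_sub (f g : VecL2) : coeffSeq (f - g : VecL2) = coeffSeq f - coeffSeq g := by
  ext k i
  have hi : ∀ h : VecL2, Integrable (fun x => mFourier (-k) x • component i h x) := fun h =>
    (memLp_mFourier_mul (memLp_component (Lp.memLp h) i) (-k)).integrable (by norm_num)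
  show mFourierCoeff (component i (f - g : VecL2)) k =
    mFourierCoeff (component i f) k - mFourierCoeff (component i g) k
  unfold mFourierCoeff
  rw [← integral_sub (hi f) (hi g)]
  apply integral_congr_ae
  filter_upwards [Lp.coeFn_sub f g] with x hx
  simp only [component, hx, Pi.sub_apply, PiLp.sub_apply, Complex.ofReal_sub, smul_eq_mul, mul_sub]

/-! ### The fractional Laplacian -/

lemma weight_rpow_ge {r : ℝ} (hr : 0 ≤ r) (k : Freq) :
    waveNumber k ^ (2 * r) ≤ weight k ^ r := by
  rw [Real.rpow_mul (waveNumber_nonneg k), Real.rpow_two]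
  exact Real.rpow_le_rpow (sq_nonneg _) (by unfold weight; linarith) hr

lemma summable_weight_mul_dotRe {r : ℝ} {a : VecSeq} (h : seqNormSq r a < ∞) :
    Summable fun k => weight k ^ r * dotRe a a k := by
  rw [seqNormSq_eq_tsum_dotRe] at h
  have := ENNReal.summable_toReal h.ne
  refine this.congr fun k => ?_
  rw [ENNReal.toReal_ofReal]
  exact mul_nonneg (Real.rpow_nonneg (weight_pos k).le _) (dotRe_self_nonneg a k)

lemma summable_waveNumber_mul_dotRe {r : ℝ} (hr : 0 ≤ r) {a : VecSeq} (h : seqNormSq r a < ∞) :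
    Summable fun k => waveNumber k ^ (2 * r) * dotRe a a k :=
  (summable_weight_mul_dotRe h).of_nonneg_of_le
    (fun k => mul_nonneg (Real.rpow_nonneg (waveNumber_nonneg k) _) (dotRe_self_nonneg a k))
    fun k => mul_le_mul_of_nonneg_right (weight_rpow_ge hr k) (dotRe_self_nonneg a k)

lemma two_mul_abs_dotRe_le (a b : VecSeq) (k : Freq) :
    2 * |dotRe a b k| ≤ dotRe a a k + dotRe b b k := by
  rw [dotRe_self, dotRe_self, ← Finset.sum_add_distrib]
  unfold dotRe
  calc _ ≤ 2 * ∑ i, |(a k i * (starRingEnd ℂ) (b k i)).re| := by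
        gcongr; exact Finset.abs_sum_le_sum_abs _ _
    _ = ∑ i, 2 * |(a k i * (starRingEnd ℂ) (b k i)).re| := Finset.mul_sum _ _ _
    _ ≤ _ := Finset.sum_le_sum fun i _ => by
        have h1 := Complex.abs_re_le_norm (a k i * (starRingEnd ℂ) (b k i))
        rw [norm_mul, RCLike.norm_conj] at h1
        nlinarith [sq_nonneg (‖a k i‖ - ‖b k i‖)]

lemma summable_waveNumber_mul_dotRe' {r : ℝ} (hr : 0 ≤ r) {a b : VecSeq}
    (ha : seqNormSq r a < ∞) (hb : seqNormSq r b < ∞) :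
    Summable fun k => waveNumber k ^ (2 * r) * dotRe a b k := by
  refine Summable.of_norm_bounded ((summable_waveNumber_mul_dotRe hr ha).add
    (summable_waveNumber_mul_dotRe hr hb)) fun k => ?_
  rw [Real.norm_eq_abs, abs_mul, abs_of_nonneg (Real.rpow_nonneg (waveNumber_nonneg k) _),
    ← mul_add]
  gcongr
  · exact Real.rpow_nonneg (waveNumber_nonneg k) _
  · linarith [two_mul_abs_dotRe_le a b k, abs_nonneg (dotRe a b k)]

/-- The inner product `∫ A^{r/2} f · A^{r/2} g` in terms of the coefficients. -/
def dissip (r : ℝ) (a b : VecSeq) : ℝ := ∑' k, waveNumber k ^ (2 * r) * dotRe a b k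

lemma memLp_frac {r : ℝ} (hr : 0 ≤ r) {f : Torus → Vec} (h : seqNormSq r (coeffSeq f) < ∞)
    (i : Fin 3) :
    Memℓp (fun k : Freq => ((waveNumber k ^ (2 * (r / 2)) : ℝ) : ℂ) * coeff i f k) 2 := by
  apply memℓp_gen
  refine (summable_waveNumber_mul_dotRe hr h).of_nonneg_of_le (fun k => by positivity) fun k => ?_
  rw [show (2 : ℝ≥0∞).toReal = 2 by norm_num, Real.rpow_two, norm_mul, mul_pow, dotRe_self]
  have e : ‖((waveNumber k ^ (2 * (r / 2)) : ℝ) : ℂ)‖ ^ 2 = waveNumber k ^ (2 * r) := by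
    rw [Complex.norm_real, Real.norm_of_nonneg (Real.rpow_nonneg (waveNumber_nonneg k) _),
      ← Real.rpow_natCast, ← Real.rpow_mul (waveNumber_nonneg k)]
    congr 1; push_cast; ring
  rw [e]
  gcongr
  · exact Real.rpow_nonneg (waveNumber_nonneg k) _
  · exact Finset.single_le_sum (f := fun i => ‖coeffSeq f k i‖ ^ 2) (fun _ _ => sq_nonneg _)
      (Finset.mem_univ i)

/-- Finiteness of the `Hʳ` norm makes the multiplied coefficients square-summable, so the `tsum`
defining `fracLap` is a genuine expansion in the Fourier basis and not the default value `0`. -/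
lemma fracLap_eq {r : ℝ} (hr : 0 ≤ r) {f : Torus → Vec} (h : seqNormSq r (coeffSeq f) < ∞)
    (i : Fin 3) :
    fracLap (r / 2) i f = mFourierBasis.repr.symm ⟨_, memLp_frac hr h i⟩ := by
  have := mFourierBasis.hasSum_repr_symm ⟨_, memLp_frac hr h i⟩
  rw [coe_mFourierBasis] at this
  exact this.tsum_eq

lemma fracInner_eq_dissip {r : ℝ} (hr : 0 ≤ r) {f g : Torus → Vec}
    (hf : seqNormSq r (coeffSeq f) < ∞) (hg : seqNormSq r (coeffSeq g) < ∞) :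
    fracInner (r / 2) f g = dissip r (coeffSeq f) (coeffSeq g) := by
  unfold fracInner
  have key : ∀ i, HasSum (fun k => waveNumber k ^ (2 * r) *
      (coeff i f k * (starRingEnd ℂ) (coeff i g k)).re)
      (inner ℂ (fracLap (r / 2) i f) (fracLap (r / 2) i g)).re := by
    intro i
    rw [fracLap_eq hr hf i, fracLap_eq hr hg i, LinearIsometryEquiv.inner_map_map]
    have := Complex.hasSum_re (lp.hasSum_inner (𝕜 := ℂ) (⟨_, memLp_frac hr hf i⟩ :
      lp (fun _ : Freq => ℂ) 2) ⟨_, memLp_frac hr hg i⟩)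
    refine this.congr_fun fun k => ?_
    have e : waveNumber k ^ (2 * r) =
        waveNumber k ^ (2 * (r / 2)) * waveNumber k ^ (2 * (r / 2)) := by
      rw [← sq, ← Real.rpow_natCast, ← Real.rpow_mul (waveNumber_nonneg k)]
      congr 1; push_cast; ring
    rw [e]
    simp only [RCLike.inner_apply, map_mul, Complex.conj_ofReal, Complex.mul_re, Complex.mul_im,
      Complex.conj_re, Complex.conj_im, Complex.ofReal_re, Complex.ofReal_im]
    ring
  have := (hasSum_sum fun i (_ : i ∈ Finset.univ) => key i).tsum_eq
  rw [← this]
  unfold dissip dotRe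
  refine tsum_congr fun k => ?_
  rw [Finset.mul_sum]; rfl

lemma dissip_sub {r : ℝ} (hr : 0 ≤ r) {a b : VecSeq} (ha : seqNormSq r a < ∞)
    (hb : seqNormSq r b < ∞) :
    dissip r (a - b) (a - b) = dissip r a a + dissip r b b - 2 * dissip r a b := by
  have h1 := summable_waveNumber_mul_dotRe hr ha
  have h2 := summable_waveNumber_mul_dotRe hr hb
  have h3 := (summable_waveNumber_mul_dotRe' hr ha hb).mul_left 2
  unfold dissip
  rw [← tsum_mul_left, ← h1.tsum_add h2, ← (h1.add h2).tsum_sub h3]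
  refine tsum_congr fun k => ?_
  simp only [dotRe, Pi.sub_apply, Fin.sum_univ_three, map_sub, Complex.mul_re, Complex.sub_re,
    Complex.sub_im, Complex.conj_re, Complex.conj_im]
  ring

/-- Since `weight k ≤ 2 max(1, |2πk|²)`, the inhomogeneous weight costs only the factor `2 ^ r`. The
`1` is needed at the zero mode, which the dissipation does not see. -/
lemma weight_rpow_le {r : ℝ} (hr : 0 ≤ r) (k : Freq) :
    weight k ^ r ≤ 2 ^ r * (1 + waveNumber k ^ (2 * r)) := by
  have hw : 0 ≤ waveNumber k ^ 2 := sq_nonneg _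
  rw [Real.rpow_mul (waveNumber_nonneg k), Real.rpow_two]
  have h1 : weight k ≤ 2 * max 1 (waveNumber k ^ 2) := by
    unfold weight
    linarith [le_max_left 1 (waveNumber k ^ 2), le_max_right 1 (waveNumber k ^ 2)]
  calc _ ≤ (2 * max 1 (waveNumber k ^ 2)) ^ r := Real.rpow_le_rpow (weight_pos k).le h1 hr
    _ = 2 ^ r * (max 1 (waveNumber k ^ 2)) ^ r := Real.mul_rpow (by norm_num) (by positivity)
    _ ≤ _ := by
      gcongr
      rcases le_total 1 (waveNumber k ^ 2) with h | h
      · rw [max_eq_right h]; linarith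
      · rw [max_eq_left h, Real.one_rpow]
        linarith [Real.rpow_nonneg hw r]

lemma dissip_self_nonneg (r : ℝ) (a : VecSeq) : 0 ≤ dissip r a a :=
  tsum_nonneg fun k =>
    mul_nonneg (Real.rpow_nonneg (waveNumber_nonneg k) _) (dotRe_self_nonneg a k)

lemma seqNormSq_toReal_le {r : ℝ} (hr : 0 ≤ r) (f : VecL2) (h : seqNormSq r (coeffSeq f) < ∞) :
    (seqNormSq r (coeffSeq f)).toReal ≤
      2 ^ r * (‖f‖ ^ 2 + dissip r (coeffSeq f) (coeffSeq f)) := by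
  have h0 := hasSum_dotRe_inner f f
  rw [real_inner_self_eq_norm_sq] at h0
  have h1 := summable_waveNumber_mul_dotRe hr h
  rw [← h0.tsum_eq, dissip, ← h0.summable.tsum_add h1, ← tsum_mul_left, seqNormSq_eq_tsum_dotRe,
    ← ENNReal.ofReal_tsum_of_nonneg (fun k => mul_nonneg (Real.rpow_nonneg (weight_pos k).le _)
      (dotRe_self_nonneg _ k)) (summable_weight_mul_dotRe h), ENNReal.toReal_ofReal
      (tsum_nonneg fun k => mul_nonneg (Real.rpow_nonneg (weight_pos k).le _)
      (dotRe_self_nonneg _ k))]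
  refine (summable_weight_mul_dotRe h).tsum_le_tsum (fun k => ?_) ((h0.summable.add h1).mul_left _)
  calc _ ≤ 2 ^ r * (1 + waveNumber k ^ (2 * r)) * dotRe (coeffSeq f) (coeffSeq f) k :=
        mul_le_mul_of_nonneg_right (weight_rpow_le hr k) (dotRe_self_nonneg _ k)
    _ = _ := by ring

lemma dissip_self_le {r : ℝ} (hr : 0 ≤ r) {a : VecSeq} (h : seqNormSq r a < ∞) :
    dissip r a a ≤ (seqNormSq r a).toReal := by
  rw [seqNormSq_eq_tsum_dotRe,
    ← ENNReal.ofReal_tsum_of_nonneg (fun k => mul_nonneg (Real.rpow_nonneg (weight_pos k).le _)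
      (dotRe_self_nonneg _ k)) (summable_weight_mul_dotRe h), ENNReal.toReal_ofReal
      (tsum_nonneg fun k => mul_nonneg (Real.rpow_nonneg (weight_pos k).le _)
      (dotRe_self_nonneg _ k))]
  exact (summable_waveNumber_mul_dotRe hr h).tsum_le_tsum (fun k =>
    mul_le_mul_of_nonneg_right (weight_rpow_ge hr k) (dotRe_self_nonneg a k))
    (summable_weight_mul_dotRe h)

/-- If the coefficients of `g` live at one wave number, `Aʳ` acts on `g` as a scalar. -/
lemma fracInner_eq_of_support {r : ℝ} (hr : 0 ≤ r) {f g : Torus → Vec}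
    (hf : MemLp f 2) (hfr : seqNormSq r (coeffSeq f) < ∞) (hg : MemLp g 2) {ρ : ℝ}
    (h : ∀ k, waveNumber k ≠ ρ → coeffSeq g k = 0) :
    fracInner (r / 2) f g = ρ ^ (2 * r) * ∫ x, ∑ i, f x i * g x i := by
  have hgr : seqNormSq r (coeffSeq g) < ∞ := by
    have h0 := seqNormSq_zero_coeffSeq hg
    have hle : seqNormSq r (coeffSeq g) ≤
        ENNReal.ofReal ((1 + ρ ^ 2) ^ r) * seqNormSq 0 (coeffSeq g) := by
      rw [seqNormSq_eq_tsum_dotRe, seqNormSq_eq_tsum_dotRe, ← ENNReal.tsum_mul_left]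
      refine ENNReal.tsum_le_tsum fun k => ?_
      by_cases hk : waveNumber k = ρ
      · rw [← ENNReal.ofReal_mul (Real.rpow_nonneg (by positivity) _), Real.rpow_zero, one_mul,
          weight, hk]
      · simp [dotRe_self, h k hk]
    exact hle.trans_lt (ENNReal.mul_lt_top ENNReal.ofReal_lt_top (h0 ▸ ENNReal.ofReal_lt_top))
  rw [fracInner_eq_dissip hr hfr hgr, ← (hasSum_dotRe hf hg).tsum_eq, ← tsum_mul_left]
  refine tsum_congr fun k => ?_
  by_cases hk : waveNumber k = ρ
  · rw [hk]
  · simp [dotRe, h k hk]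

/-! ### Trigonometric test fields -/

lemma hasDerivAt_mFourier_add_single (n : Freq) (x : Torus) (j : Fin 3) :
    HasDerivAt (fun h : ℝ => mFourier n (x + Pi.single j (h : UnitAddCircle)))
      (2 * Real.pi * Complex.I * n j * mFourier n x) 0 := by
  have e : ∀ h : ℝ, mFourier n (x + Pi.single j (h : UnitAddCircle)) =
      mFourier n x * fourier (n j) (h : UnitAddCircle) := by
    intro h
    simp only [mFourier, ContinuousMap.coe_mk]
    have h1 : ∀ i, fourier (n i) ((x + Pi.single j (h : UnitAddCircle) : Torus) i) =
        fourier (n i) (x i) * fourier (n i) ((Pi.single j (h : UnitAddCircle) : Torus) i) := by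
      intro i
      simp only [fourier_apply, Pi.add_apply, smul_add, AddCircle.toCircle_add, Circle.coe_mul]
    rw [Finset.prod_congr rfl fun i _ => h1 i, Finset.prod_mul_distrib]
    congr 1
    rw [Finset.prod_eq_single j]
    · rw [Pi.single_eq_same]
    · intro i _ hi
      rw [Pi.single_eq_of_ne hi, fourier_eval_zero]
    · simp
  have h2 := (hasDerivAt_fourier (1 : ℝ) (n j) 0).const_mul (mFourier n x)
  simp only [e]
  convert! h2 using 1
  rw [QuotientAddGroup.mk_zero, fourier_eval_zero]
  push_cast
  ring

lemma contDiff_mFourier_proj (n : Freq) :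
    ContDiff ℝ (⊤ : ℕ∞) (fun x : Fin 3 → ℝ => mFourier n (proj x)) := by
  have e : ∀ x : Fin 3 → ℝ, mFourier n (proj x) =
      ∏ i, Complex.exp (2 * Real.pi * Complex.I * n i * (x i : ℝ)) := by
    intro x
    simp only [mFourier, ContinuousMap.coe_mk, proj]
    refine Finset.prod_congr rfl fun i _ => ?_
    rw [fourier_coe_apply]
    simp
  simp only [e]
  refine contDiff_prod fun i _ => ?_
  refine ContDiff.cexp (contDiff_const.mul ?_)
  exact Complex.ofRealCLM.contDiff.comp (contDiff_apply ℝ ℝ i)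

/-- The field `x ↦ L (exp (2πi n·x)) a`, where `L` is the real or the imaginary part. -/
def trigField (L : ℂ →L[ℝ] ℝ) (a : Fin 3 → ℝ) (n : Freq) (x : Torus) : Vec :=
  WithLp.toLp 2 fun i => a i * L (mFourier n x)

lemma partialDeriv_mul_trig (L : ℂ →L[ℝ] ℝ) (c : ℝ) (n : Freq) (j : Fin 3) (x : Torus) :
    partialDeriv j (fun y => c * L (mFourier n y)) x =
      c * L (2 * Real.pi * Complex.I * n j * mFourier n x) := by
  unfold partialDeriv
  exact ((L.hasFDerivAt.comp_hasDerivAt 0 (hasDerivAt_mFourier_add_single n x j)).const_mul c).deriv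

lemma continuous_trigField (L : ℂ →L[ℝ] ℝ) (a : Fin 3 → ℝ) (n : Freq) :
    Continuous (trigField L a n) := by
  unfold trigField
  fun_prop

lemma memLp_trigField (L : ℂ →L[ℝ] ℝ) (a : Fin 3 → ℝ) (n : Freq) :
    MemLp (trigField L a n) 2 :=
  (continuous_trigField L a n).memLp_of_hasCompactSupport (HasCompactSupport.of_compactSpace _)

lemma isTestFunction_smul_trigField {T : ℝ} {φ : ℝ → ℝ} (hφ : ContDiff ℝ (⊤ : ℕ∞) φ)
    (hz : ∃ T' < T, ∀ t, T' ≤ t → φ t = 0) (L : ℂ →L[ℝ] ℝ) (a : Fin 3 → ℝ) (n : Freq) :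
    IsTestFunction T (fun t x => φ t • trigField L a n x) := by
  refine ⟨?_, ?_⟩
  · refine (hφ.comp contDiff_fst).smul ?_
    rw [contDiff_euclidean]
    intro i
    refine contDiff_const.mul (L.contDiff.comp ?_)
    exact (contDiff_mFourier_proj n).comp contDiff_snd
  · obtain ⟨T', hT', h⟩ := hz
    exact ⟨T', hT', fun t ht x => by simp [h t ht]⟩

lemma integral_apply_mul_trig {f : Torus → Vec} (hf : MemLp f 2) (i : Fin 3) (L : ℂ →L[ℝ] ℝ)
    (k : Freq) : ∫ x, f x i * L (mFourier (-k) x) = L (coeff i f k) := by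
  unfold coeff mFourierCoeff
  simp only [smul_eq_mul]
  rw [← L.integral_comp_comm
    ((memLp_mFourier_mul (memLp_component hf i) (-k)).integrable (by norm_num))]
  congr 1; ext x
  rw [← smul_eq_mul, ← map_smul]
  congr 1
  simp [component, mul_comm]

lemma integrable_apply_mul_trig {f : Torus → Vec} (hf : MemLp f 2) (i : Fin 3) (L : ℂ →L[ℝ] ℝ)
    (k : Freq) : Integrable fun x => f x i * L (mFourier (-k) x) := by
  have := L.integrable_comp
    ((memLp_mFourier_mul (memLp_component hf i) (-k)).integrable (by norm_num))
  refine this.congr (Filter.Eventually.of_forall fun x => ?_)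
  show L _ = f x i * L _
  rw [← smul_eq_mul (a := f x i), ← map_smul]
  congr 1
  simp [component, mul_comm]

lemma integrable_mFourier_mul_component_mul {f : Torus → Vec} (hf : MemLp f 2) (i j : Fin 3)
    (k : Freq) : Integrable fun x => mFourier (-k) x • (component i f x * component j f x) := by
  have := (memLp_mFourier_mul (memLp_component hf i) (-k)).integrable_mul (memLp_component hf j)
  refine this.congr (Filter.Eventually.of_forall fun x => ?_)
  simp [mul_assoc]

lemma integral_apply_mul_apply_mul_trig {f : Torus → Vec} (hf : MemLp f 2) (i j : Fin 3)
    (L : ℂ →L[ℝ] ℝ) (k : Freq) (z : ℂ) :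
    ∫ x, f x i * f x j * L (z * mFourier (-k) x) = L (z * coeffMul f f i j k) := by
  unfold coeffMul mFourierCoeff
  rw [← integral_const_mul, ← L.integral_comp_comm
    ((integrable_mFourier_mul_component_mul hf i j k).const_mul z)]
  congr 1; ext x
  rw [← smul_eq_mul (a := f x i * f x j), ← map_smul]
  congr 1
  simp only [component, Complex.real_smul, smul_eq_mul]
  push_cast
  ring

lemma integrable_apply_mul_apply_mul_trig {f : Torus → Vec} (hf : MemLp f 2) (i j : Fin 3)
    (L : ℂ →L[ℝ] ℝ) (k : Freq) (z : ℂ) :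
    Integrable fun x => f x i * f x j * L (z * mFourier (-k) x) := by
  have := L.integrable_comp ((integrable_mFourier_mul_component_mul hf i j k).const_mul z)
  refine this.congr (Filter.Eventually.of_forall fun x => ?_)
  show L _ = f x i * f x j * L _
  rw [← smul_eq_mul (a := f x i * f x j), ← map_smul]
  congr 1
  simp only [component, Complex.real_smul, smul_eq_mul]
  push_cast
  ring

lemma mFourierCoeff_mFourier (n m : Freq) :
    mFourierCoeff (mFourier n : Torus → ℂ) m = if m = n then 1 else 0 := by
  classical
  have h := mFourierBasis_repr (mFourierBasis n : Lp ℂ 2 (volume : Measure Torus)) m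
  rw [mFourierBasis.repr_self, lp.single_apply, coe_mFourierBasis] at h
  rw [← mFourierCoeff_toLp, ← h, Pi.single_apply]

/-- A real-linear functional is a combination of `z` and its conjugate; hence `L` applied to
`mFourier n` has frequencies `n` and `-n` only, which share one wave number. -/
lemma realLinear_eq (L : ℂ →L[ℝ] ℝ) (z : ℂ) :
    ((L z : ℝ) : ℂ) = (L 1 - Complex.I * L Complex.I) / 2 * z +
      (L 1 + Complex.I * L Complex.I) / 2 * (starRingEnd ℂ) z := by
  have : L z = z.re * L 1 + z.im * L Complex.I := by
    conv_lhs => rw [← Complex.re_add_im z]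
    have e : ((z.re : ℂ) + z.im * Complex.I) = z.re • (1 : ℂ) + z.im • Complex.I := by simp
    rw [e, map_add, map_smul, map_smul, smul_eq_mul, smul_eq_mul]
  rw [this]
  apply Complex.ext <;> simp <;> ring

lemma coeffSeq_smul_trigField_eq_zero (L : ℂ →L[ℝ] ℝ) (a : Fin 3 → ℝ) (n m : Freq) (c : ℝ)
    (h : waveNumber m ≠ waveNumber n) :
    coeffSeq (fun x => c • trigField L a n x) m = 0 := by
  ext i
  have h1 : m ≠ n := fun e => h (by rw [e])
  have h2 : m ≠ -n := fun e => h (by rw [e, waveNumber_neg])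
  have i1 : ∀ n : Freq, Integrable fun x : Torus => mFourier (-m) x • mFourier n x := fun n =>
    (BoundedContinuousFunction.mkOfCompact ((mFourier (-m)) * mFourier n)).integrable volume
  have e : ∀ x : Torus, mFourier (-m) x • component i (fun x => c • trigField L a n x) x =
      (c * a i * ((L 1 - Complex.I * L Complex.I) / 2)) * (mFourier (-m) x • mFourier n x) +
      (c * a i * ((L 1 + Complex.I * L Complex.I) / 2)) * (mFourier (-m) x • mFourier (-n) x) := by
    intro x
    have : component i (fun x => c • trigField L a n x) x = c * a i * (L (mFourier n x) : ℝ) := by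
      simp [component, trigField, mul_assoc]
    rw [this, realLinear_eq, mFourier_neg (n := n)]
    simp only [smul_eq_mul]
    ring
  show mFourierCoeff _ m = 0
  have k1 := mFourierCoeff_mFourier n m
  have k2 := mFourierCoeff_mFourier (-n) m
  rw [if_neg h1] at k1
  rw [if_neg h2] at k2
  unfold mFourierCoeff at k1 k2 ⊢
  simp only [e]
  rw [integral_add ((i1 n).const_mul _) ((i1 (-n)).const_mul _), integral_const_mul,
    integral_const_mul, k1, k2]
  simp

/-- Test the weak divergence with `L (mFourier (-k))`; the real and imaginary parts as `L` recover
the complex identity. -/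
lemma isDivFreeSeq_coeffSeq {f : Torus → Vec} (hf : MemLp f 2) (h : DivFree f) :
    IsDivFreeSeq (coeffSeq f) := by
  intro k
  have key : ∀ L : ℂ →L[ℝ] ℝ, L (2 * Real.pi * Complex.I * ∑ j, (k j : ℂ) * coeffSeq f k j) = 0 := by
    intro L
    have h1 := h (fun x => 1 * L (mFourier (-k) x)) (by
      refine contDiff_const.mul (L.contDiff.comp (contDiff_mFourier_proj _)))
    simp only [partialDeriv_mul_trig] at h1
    simp only [one_mul] at h1
    have h2 : ∀ j, ∀ x, f x j * L (2 * Real.pi * Complex.I * ((-k) j : ℤ) * mFourier (-k) x) =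
        f x j * (L ∘L ((2 * Real.pi * Complex.I * ((-k) j : ℤ)) •
          ContinuousLinearMap.id ℝ ℂ)) (mFourier (-k) x) := by
      intro j x; simp
    simp only [h2] at h1
    rw [integral_finsetSum _ fun j _ => integrable_apply_mul_trig hf j _ k] at h1
    simp only [integral_apply_mul_trig hf] at h1
    simp only [ContinuousLinearMap.comp_apply, smul_apply,
      ContinuousLinearMap.id_apply, smul_eq_mul] at h1
    rw [← map_sum] at h1
    rw [← neg_eq_zero, ← map_neg, ← h1]
    congr 1
    rw [Finset.mul_sum, ← Finset.sum_neg_distrib]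
    refine Finset.sum_congr rfl fun j _ => ?_
    simp [coeffSeq]; ring
  have hz : 2 * Real.pi * Complex.I * ∑ j, (k j : ℂ) * coeffSeq f k j = 0 :=
    Complex.ext (key Complex.reCLM) (key Complex.imCLM)
  have hpi : (2 * Real.pi * Complex.I : ℂ) ≠ 0 := by
    simp [Real.pi_ne_zero]
  exact (mul_eq_zero.1 hz).resolve_left hpi

/-! ### The equations for the Fourier modes -/

/-- The matrix, at the frequency `k`, of the projection onto divergence-free fields. -/
def lerayMatrix (k : Freq) (i l : Fin 3) : ℝ :=
  (if i = l then 1 else 0) - (k i : ℝ) * k l / ∑ j, (k j : ℝ) ^ 2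

lemma sum_lerayMatrix_mul_freq (k : Freq) (i : Fin 3) :
    ∑ l, lerayMatrix k i l * k l = 0 := by
  unfold lerayMatrix
  -- At `k = 0` division by zero makes the matrix the identity, and the claim holds because `k`
  -- vanishes.
  by_cases hk : ∑ j, (k j : ℝ) ^ 2 = 0
  · have : ∀ j, (k j : ℝ) = 0 := fun j => by
      have := (Finset.sum_eq_zero_iff_of_nonneg fun j _ => sq_nonneg (k j : ℝ)).1 hk j
        (Finset.mem_univ j)
      simpa using this
    simp [this]
  · simp only [sub_mul, Finset.sum_sub_distrib, ite_mul, one_mul, zero_mul, Finset.sum_ite_eq,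
      Finset.mem_univ, if_true]
    have : ∀ l, (k i : ℝ) * k l / (∑ j, (k j : ℝ) ^ 2) * k l =
        (k i / (∑ j, (k j : ℝ) ^ 2)) * (k l : ℝ) ^ 2 := fun l => by ring
    simp only [this]
    rw [← Finset.mul_sum, div_mul_cancel₀ _ hk, sub_self]

lemma sum_lerayMatrix_mul {k : Freq} {z : Fin 3 → ℂ} (hz : ∑ j, (k j : ℂ) * z j = 0) (i : Fin 3) :
    ∑ l, (lerayMatrix k i l : ℂ) * z l = z i := by
  unfold lerayMatrix
  have h : ∀ l, (((if i = l then 1 else 0) - (k i : ℝ) * k l / ∑ j, (k j : ℝ) ^ 2 : ℝ) : ℂ) * z l =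
      (if i = l then z l else 0) - ((k i : ℂ) / (∑ j, (k j : ℝ) ^ 2 : ℝ)) * (k l * z l) := by
    intro l
    split_ifs <;> push_cast <;> ring
  simp only [h, Finset.sum_sub_distrib, ← Finset.mul_sum, hz, mul_zero, sub_zero,
    Finset.sum_ite_eq, Finset.mem_univ, if_true]

lemma lerayMatrix_comm (k : Freq) (i l : Fin 3) : lerayMatrix k i l = lerayMatrix k l i := by
  unfold lerayMatrix
  simp only [eq_comm (a := i), mul_comm (k i : ℝ)]

/-- The Fourier coefficients of `div (f ⊗ f)`. -/
def divTensor (f : Torus → Vec) (k : Freq) (l : Fin 3) : ℂ :=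
  ∑ j, 2 * Real.pi * Complex.I * k j * coeffMul f f l j k

/-- The right-hand side of the equation for the Fourier coefficients of a weak solution. -/
def modeRhs (s ν : ℝ) (f : Torus → Vec) (k : Freq) (i : Fin 3) : ℂ :=
  -(ν * (waveNumber k ^ (2 * s) : ℝ)) * coeff i f k -
    ∑ l, (lerayMatrix k i l : ℂ) * divTensor f k l

/-- The amplitude is row `i` of the Leray matrix. The test field is then divergence free, so the
pressure disappears slice by slice; and because the matrix fixes the divergence-free vector of
coefficients of `f`, the pairing still returns the `i`-th coefficient itself. -/
lemma weak_integrand_eq {s ν : ℝ} (hs : 0 ≤ s) {f : Torus → Vec} (hf : MemLp f 2)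
    (hfs : seqNormSq s (coeffSeq f) < ∞) (hdiv : IsDivFreeSeq (coeffSeq f)) {φ : ℝ → ℝ}
    (hφ : Differentiable ℝ φ) (L : ℂ →L[ℝ] ℝ) (k : Freq) (i : Fin 3) (t : ℝ) (P : Torus → ℝ)
    {ψ : ℝ → Torus → Vec} (hψ : ψ = fun t x => φ t • trigField L (lerayMatrix k i) (-k) x) :
    ((∫ x, ∑ i, f x i * deriv (fun τ => ψ τ x i) t)
        - ν * fracInner (s / 2) f (ψ t)
        + (∫ x, ∑ i, ∑ j, f x i * f x j * partialDeriv j (fun y => ψ t y i) x)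
        + ∫ x, P x * ∑ j, partialDeriv j (fun y => ψ t y j) x) =
      deriv φ t * L (coeff i f k) + φ t * L (modeRhs s ν f k i) := by
  have hψi : ∀ t x l, ψ t x l = (φ t * lerayMatrix k i l) * L (mFourier (-k) x) := by
    intro t x l; rw [hψ]; simp [trigField, mul_assoc]
  have hsum : ∑ l, lerayMatrix k i l * L (coeff l f k) = L (coeff i f k) := by
    have := sum_lerayMatrix_mul (hdiv k) i
    rw [coeffSeq] at this
    rw [← this, map_sum]
    refine Finset.sum_congr rfl fun l _ => ?_
    rw [← smul_eq_mul, ← map_smul, Complex.real_smul]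
    rfl
  have t1 : ∫ x, ∑ l, f x l * deriv (fun τ => ψ τ x l) t = deriv φ t * L (coeff i f k) := by
    have e : ∀ x l, f x l * deriv (fun τ => ψ τ x l) t =
        (deriv φ t * lerayMatrix k i l) * (f x l * L (mFourier (-k) x)) := by
      intro x l
      simp only [hψi]
      rw [deriv_mul_const ((hφ t).mul_const _), deriv_mul_const (hφ t)]
      ring
    simp only [e]
    rw [integral_finsetSum _ fun l _ => (integrable_apply_mul_trig hf l L k).const_mul _]
    simp only [integral_const_mul, integral_apply_mul_trig hf]
    rw [← hsum, Finset.mul_sum]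
    exact Finset.sum_congr rfl fun l _ => by ring
  have t2 : fracInner (s / 2) f (ψ t) = waveNumber k ^ (2 * s) * (φ t * L (coeff i f k)) := by
    have hmem : MemLp (ψ t) 2 := by
      rw [hψ]
      exact (memLp_trigField L (lerayMatrix k i) (-k)).const_smul (φ t)
    rw [fracInner_eq_of_support hs hf hfs hmem (ρ := waveNumber k)]
    · congr 1
      have e : ∀ x l, f x l * ψ t x l =
          (φ t * lerayMatrix k i l) * (f x l * L (mFourier (-k) x)) := by
        intro x l; rw [hψi]; ring
      simp only [e]
      rw [integral_finsetSum _ fun l _ => (integrable_apply_mul_trig hf l L k).const_mul _]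
      simp only [integral_const_mul, integral_apply_mul_trig hf]
      rw [← hsum, Finset.mul_sum]
      exact Finset.sum_congr rfl fun l _ => by ring
    · intro m hm
      rw [hψ]
      exact coeffSeq_smul_trigField_eq_zero L _ (-k) m (φ t) (by rwa [waveNumber_neg])
  have hp : ∀ j l x, partialDeriv j (fun y => ψ t y l) x = (φ t * lerayMatrix k i l) *
      L (-(2 * Real.pi * Complex.I * k j) * mFourier (-k) x) := by
    intro j l x
    simp only [hψi]
    rw [partialDeriv_mul_trig]
    congr 3
    simp
  have t3 : ∫ x, ∑ l, ∑ j, f x l * f x j * partialDeriv j (fun y => ψ t y l) x =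
      φ t * L (-∑ l, (lerayMatrix k i l : ℂ) * divTensor f k l) := by
    have e : ∀ x l j, f x l * f x j * partialDeriv j (fun y => ψ t y l) x =
        (φ t * lerayMatrix k i l) * (f x l * f x j *
          L (-(2 * Real.pi * Complex.I * k j) * mFourier (-k) x)) := by
      intro x l j; rw [hp]; ring
    simp only [e]
    rw [integral_finsetSum _ fun l _ => integrable_finsetSum _ fun j _ =>
      (integrable_apply_mul_apply_mul_trig hf l j L k _).const_mul _]
    have e2 : ∀ l, ∫ x, ∑ j, (φ t * lerayMatrix k i l) * (f x l * f x j *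
          L (-(2 * Real.pi * Complex.I * k j) * mFourier (-k) x)) =
        φ t * L (-((lerayMatrix k i l : ℂ) * divTensor f k l)) := by
      intro l
      rw [integral_finsetSum _ fun j _ =>
        (integrable_apply_mul_apply_mul_trig hf l j L k _).const_mul _]
      simp only [integral_const_mul, integral_apply_mul_apply_mul_trig hf]
      rw [← Finset.mul_sum, ← map_sum, mul_assoc, ← smul_eq_mul (lerayMatrix k i l), ← map_smul,
        Complex.real_smul, divTensor, ← mul_neg, ← Finset.sum_neg_distrib]
      simp only [neg_mul]
    simp only [e2]
    rw [← Finset.mul_sum, ← map_sum, Finset.sum_neg_distrib]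
  have t4 : ∀ x, ∑ j, partialDeriv j (fun y => ψ t y j) x = 0 := by
    intro x
    simp only [hp]
    have e : ∀ j, (φ t * lerayMatrix k i j) *
        L (-(2 * Real.pi * Complex.I * k j) * mFourier (-k) x) =
        (φ t * L (-(2 * Real.pi * Complex.I) * mFourier (-k) x)) * (lerayMatrix k i j * k j) := by
      intro j
      have : -(2 * Real.pi * Complex.I * k j) * mFourier (-k) x =
          (k j : ℝ) • (-(2 * Real.pi * Complex.I) * mFourier (-k) x) := by
        rw [Complex.real_smul]; push_cast; ring
      rw [this, map_smul, smul_eq_mul]; ring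
    simp only [e]
    rw [← Finset.mul_sum, sum_lerayMatrix_mul_freq, mul_zero]
  simp only [t4, mul_zero, integral_zero, add_zero]
  rw [t1, t2, t3]
  have t5 : L (modeRhs s ν f k i) = -(ν * waveNumber k ^ (2 * s)) * L (coeff i f k) +
      L (-∑ l, (lerayMatrix k i l : ℂ) * divTensor f k l) := by
    rw [modeRhs, sub_eq_add_neg, map_add, ← smul_eq_mul (-(ν * waveNumber k ^ (2 * s))),
      ← map_smul, Complex.real_smul]
    congr 3
    push_cast; ring
  rw [t5]; ring

/-! ### Bounds on a single Fourier mode -/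

lemma dotRe_le_norm_sq (f : VecL2) (k : Freq) :
    dotRe (coeffSeq f) (coeffSeq f) k ≤ ‖f‖ ^ 2 := by
  have h := hasSum_dotRe_inner f f
  rw [real_inner_self_eq_norm_sq] at h
  exact le_hasSum h k fun j _ => dotRe_self_nonneg _ j

lemma norm_coeff_le (f : VecL2) (k : Freq) (i : Fin 3) : ‖coeff i f k‖ ≤ ‖f‖ := by
  have h := dotRe_le_norm_sq f k
  rw [dotRe_self] at h
  have h2 : ‖coeff i f k‖ ^ 2 ≤ ∑ i, ‖coeffSeq f k i‖ ^ 2 :=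
    Finset.single_le_sum (f := fun i => ‖coeffSeq f k i‖ ^ 2) (fun _ _ => sq_nonneg _)
      (Finset.mem_univ i)
  exact le_of_sq_le_sq (h2.trans h) (norm_nonneg _)

lemma continuous_coeff (k : Freq) (i : Fin 3) : Continuous fun f : VecL2 => coeff i f k := by
  refine LipschitzWith.continuous (K := 1) (LipschitzWith.of_dist_le_mul fun f g => ?_)
  have h : coeff i f k - coeff i g k = coeff i (f - g : VecL2) k := by
    have := congrFun (congrFun (coeffSeq_sub f g) k) i
    exact this.symm
  rw [dist_eq_norm, dist_eq_norm, h, NNReal.coe_one, one_mul]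
  exact norm_coeff_le _ _ _

lemma norm_coeffMul_le (f : VecL2) (i j : Fin 3) (k : Freq) :
    ‖coeffMul f f i j k‖ ≤ ‖f‖ ^ 2 := by
  have hf := Lp.memLp f
  unfold coeffMul mFourierCoeff
  rw [← real_inner_self_eq_norm_sq, inner_eq_integral]
  refine norm_integral_le_of_norm_le
    (integrable_finsetSum _ fun i _ => integrable_apply_mul_apply hf hf i i) ?_
  filter_upwards with x
  have h1 : ‖mFourier (-k) x‖ ≤ 1 := ((mFourier (-k)).norm_coe_le_norm x).trans_eq mFourier_norm
  have h2 : ∀ i, f x i * f x i ≤ ∑ i, f x i * f x i := fun i =>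
    Finset.single_le_sum (f := fun i => f x i * f x i) (fun _ _ => mul_self_nonneg _)
      (Finset.mem_univ i)
  have h3 : ‖component i f x * component j f x‖ ≤ ∑ i, f x i * f x i := by
    simp only [component, norm_mul, Complex.norm_real, Real.norm_eq_abs]
    nlinarith [h2 i, h2 j, sq_nonneg (|f x i| - |f x j|), sq_abs (f x i), sq_abs (f x j)]
  rw [norm_smul]
  calc _ ≤ 1 * ‖component i f x * component j f x‖ := by gcongr
    _ ≤ _ := by rw [one_mul]; exact h3

/-! ### Measurability in time -/

section Time

variable {μ : Measure ℝ} {u : ℝ → VecL2}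

lemma aestronglyMeasurable_coeff (hu : AEStronglyMeasurable u μ) (k : Freq) (i : Fin 3) :
    AEStronglyMeasurable (fun t => coeff i (u t) k) μ :=
  (continuous_coeff k i).comp_aestronglyMeasurable hu

/-- As a limit of finite convolution sums this depends on `u` through its coefficients only, so no
joint measurability in time and space is needed. -/
lemma aestronglyMeasurable_coeffMul (hu : AEStronglyMeasurable u μ) (i j : Fin 3) (k : Freq) :
    AEStronglyMeasurable (fun t => coeffMul (u t) (u t) i j k) μ := by
  refine aestronglyMeasurable_of_tendsto_ae (Filter.atTop : Filter (Finset Freq))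
    (f := fun s t => ∑ p ∈ s, coeff j (u t) p * coeff i (u t) (k - p)) (fun s => ?_)
    (Filter.Eventually.of_forall fun t =>
      hasSum_coeffMul (Lp.memLp (u t)) (Lp.memLp (u t)) i j k)
  exact Finset.aestronglyMeasurable_fun_sum _ fun p _ =>
    (aestronglyMeasurable_coeff hu p j).mul (aestronglyMeasurable_coeff hu (k - p) i)

lemma aestronglyMeasurable_modeRhs (hu : AEStronglyMeasurable u μ) (s ν : ℝ) (k : Freq)
    (i : Fin 3) : AEStronglyMeasurable (fun t => modeRhs s ν (u t) k i) μ := by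
  unfold modeRhs divTensor
  refine ((aestronglyMeasurable_coeff hu k i).const_mul _).sub ?_
  refine Finset.aestronglyMeasurable_fun_sum _ fun l _ => ?_
  refine AEStronglyMeasurable.const_mul ?_ _
  exact Finset.aestronglyMeasurable_fun_sum _ fun j _ =>
    (aestronglyMeasurable_coeffMul hu l j k).const_mul _

lemma aemeasurable_seqNormSq (hu : AEStronglyMeasurable u μ) (r : ℝ) :
    AEMeasurable (fun t => seqNormSq r (coeffSeq (u t))) μ := by
  unfold seqNormSq
  refine Finset.aemeasurable_fun_sum _ fun i _ => AEMeasurable.tsum fun k => ?_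
  exact ((aestronglyMeasurable_coeff hu k i).aemeasurable.enorm.pow_const 2).const_mul _

lemma aestronglyMeasurable_triTerm {a b c : ℝ → VecL2} (ha : AEStronglyMeasurable a μ)
    (hb : AEStronglyMeasurable b μ) (hc : AEStronglyMeasurable c μ) (x : Freq × Freq) :
    AEStronglyMeasurable
      (fun t => triTerm (coeffSeq (a t)) (coeffSeq (b t)) (coeffSeq (c t)) x) μ := by
  unfold triTerm coeffSeq
  refine (Finset.aestronglyMeasurable_fun_sum _ fun j _ =>
    (aestronglyMeasurable_coeff ha _ _).mul_const _).mul ?_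
  exact Finset.aestronglyMeasurable_fun_sum _ fun i _ =>
    (aestronglyMeasurable_coeff hb _ _).mul
      (Complex.continuous_conj.comp_aestronglyMeasurable (aestronglyMeasurable_coeff hc _ _))

lemma aestronglyMeasurable_dotRe {a b : ℝ → VecL2} (ha : AEStronglyMeasurable a μ)
    (hb : AEStronglyMeasurable b μ) (k : Freq) :
    AEStronglyMeasurable (fun t => dotRe (coeffSeq (a t)) (coeffSeq (b t)) k) μ := by
  unfold dotRe coeffSeq
  exact Finset.aestronglyMeasurable_fun_sum _ fun i _ =>
    Complex.continuous_re.comp_aestronglyMeasurable ((aestronglyMeasurable_coeff ha _ _).mul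
      (Complex.continuous_conj.comp_aestronglyMeasurable (aestronglyMeasurable_coeff hb _ _)))

lemma exists_norm_le (hu : MemLp u (⊤ : ℝ≥0∞) μ) : ∃ M : ℝ, ∀ᵐ t ∂μ, ‖u t‖ ≤ M := by
  refine ⟨(eLpNorm u ⊤ μ).toReal, ?_⟩
  have h := hu.eLpNorm_lt_top
  rw [eLpNorm_exponent_top] at h ⊢
  filter_upwards [ae_le_eLpNormEssSup (f := u) (μ := μ)] with t ht
  rw [← toReal_enorm]
  exact ENNReal.toReal_mono h.ne ht

lemma exists_norm_modeRhs_le (hu : MemLp u (⊤ : ℝ≥0∞) μ) (s ν : ℝ) (k : Freq) (i : Fin 3) :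
    ∃ C : ℝ, ∀ᵐ t ∂μ, ‖modeRhs s ν (u t) k i‖ ≤ C := by
  obtain ⟨M, hM⟩ := exists_norm_le hu
  refine ⟨‖-((ν : ℂ) * (waveNumber k ^ (2 * s) : ℝ))‖ * M +
    ∑ l, ‖(lerayMatrix k i l : ℂ)‖ * ∑ j, ‖2 * Real.pi * Complex.I * (k j : ℂ)‖ * M ^ 2, ?_⟩
  filter_upwards [hM] with t ht
  unfold modeRhs divTensor
  refine (norm_sub_le _ _).trans (add_le_add ?_ ?_)
  · rw [norm_mul]
    gcongr
    exact (norm_coeff_le _ _ _).trans ht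
  · refine (norm_sum_le _ _).trans (Finset.sum_le_sum fun l _ => ?_)
    rw [norm_mul]
    gcongr
    refine (norm_sum_le _ _).trans (Finset.sum_le_sum fun j _ => ?_)
    rw [norm_mul]
    gcongr
    refine (norm_coeffMul_le _ _ _ _).trans ?_
    gcongr

end Time

/-! ### The equations for the modes of a weak solution -/

lemma integrableOn_modeRhs {T : ℝ} {u : ℝ → VecL2}
    (hu : MemLp u (⊤ : ℝ≥0∞) (volume.restrict (Ioo 0 T))) (s ν : ℝ) (k : Freq) (i : Fin 3) :
    IntegrableOn (fun t => modeRhs s ν (u t) k i) (Ioo 0 T) := by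
  obtain ⟨C, hC⟩ := exists_norm_modeRhs_le hu s ν k i
  exact Integrable.of_bound (aestronglyMeasurable_modeRhs hu.1 s ν k i) C hC

lemma integrableOn_coeff {T : ℝ} {u : ℝ → VecL2}
    (hu : MemLp u (⊤ : ℝ≥0∞) (volume.restrict (Ioo 0 T))) (k : Freq) (i : Fin 3) :
    IntegrableOn (fun t => coeff i (u t) k) (Ioo 0 T) := by
  obtain ⟨C, hC⟩ := exists_norm_le hu
  exact Integrable.of_bound (aestronglyMeasurable_coeff hu.1 k i) C
    (hC.mono fun t ht => (norm_coeff_le _ _ _).trans ht)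

namespace IsWeakSolution

variable {s ν T : ℝ} {u₀ : VecL2} {u : ℝ → VecL2}

lemma ae_seqNormSq_lt_top (h : IsWeakSolution s ν T u₀ u) :
    ∀ᵐ t ∂(volume.restrict (Ioo 0 T)), seqNormSq s (coeffSeq (u t)) < ∞ :=
  ae_lt_top' (aemeasurable_seqNormSq h.bounded.1 s) h.sqIntegrable.ne

lemma ae_isDivFreeSeq (h : IsWeakSolution s ν T u₀ u) :
    ∀ᵐ t ∂(volume.restrict (Ioo 0 T)), IsDivFreeSeq (coeffSeq (u t)) :=
  h.divFree.mono fun t ht => isDivFreeSeq_coeffSeq (Lp.memLp (u t)) ht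

/-- The mode equation follows from the du Bois-Reymond lemma, the test fields being `φ(t)` times the
projected trigonometric field. The projection fixes the coefficient of `u₀` too, since `u₀` is
divergence free. -/
lemma ae_linear_coeff_eq (h : IsWeakSolution s ν T u₀ u) (hs : 0 ≤ s) (hT : 0 < T)
    (L : ℂ →L[ℝ] ℝ) (k : Freq) (i : Fin 3) :
    ∀ᵐ t ∂(volume.restrict (Ioo 0 T)), L (coeff i (u t) k) =
      L (coeff i u₀ k) + ∫ τ in (0 : ℝ)..t, L (modeRhs s ν (u τ) k i) := by
  obtain ⟨P, -, hP⟩ := h.equation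
  refine ae_eq_primitive_of_weak_deriv hT (L.integrable_comp (integrableOn_coeff h.bounded k i))
    (L.integrable_comp (integrableOn_modeRhs h.bounded s ν k i)) fun φ hφ hz => ?_
  have h1 := hP _ (isTestFunction_smul_trigField hφ hz L (lerayMatrix k i) (-k))
  have hd0 := isDivFreeSeq_coeffSeq (Lp.memLp u₀) h.initial_divFree
  have e0 : ∫ x, ∑ l, u₀ x l * (φ 0 • trigField L (lerayMatrix k i) (-k) x : Vec) l =
      φ 0 * L (coeff i u₀ k) := by
    have e : ∀ x l, u₀ x l * (φ 0 • trigField L (lerayMatrix k i) (-k) x : Vec) l =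
        (φ 0 * lerayMatrix k i l) * (u₀ x l * L (mFourier (-k) x)) := by
      intro x l; simp [trigField]; ring
    simp only [e]
    rw [integral_finsetSum _ fun l _ =>
      (integrable_apply_mul_trig (Lp.memLp u₀) l L k).const_mul _]
    simp only [integral_const_mul, integral_apply_mul_trig (Lp.memLp u₀)]
    have := sum_lerayMatrix_mul (hd0 k) i
    rw [coeffSeq] at this
    rw [← this, map_sum, Finset.mul_sum]
    refine Finset.sum_congr rfl fun l _ => ?_
    rw [mul_assoc, ← smul_eq_mul (lerayMatrix k i l), ← map_smul, Complex.real_smul]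
    rfl
  rw [e0] at h1
  rw [← h1, intervalIntegral.integral_of_le hT.le, integral_Ioc_eq_integral_Ioo,
    intervalIntegral.integral_of_le hT.le, integral_Ioc_eq_integral_Ioo]
  apply integral_congr_ae
  filter_upwards [h.ae_seqNormSq_lt_top, h.ae_isDivFreeSeq] with t ht1 ht2
  exact (weak_integrand_eq hs (Lp.memLp (u t)) ht1 ht2 (hφ.differentiable (by simp)) L k i t
    (P t) rfl).symm

lemma intervalIntegrable_modeRhs (h : IsWeakSolution s ν T u₀ u) (hT : 0 ≤ T) (k : Freq)
    (i : Fin 3) : IntervalIntegrable (fun τ => modeRhs s ν (u τ) k i) volume 0 T :=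
  (intervalIntegrable_iff_integrableOn_Ioo_of_le hT).2 (integrableOn_modeRhs h.bounded s ν k i)

lemma ae_coeff_eq (h : IsWeakSolution s ν T u₀ u) (hs : 0 ≤ s) (hT : 0 < T)
    (k : Freq) (i : Fin 3) :
    ∀ᵐ t ∂(volume.restrict (Ioo 0 T)), coeff i (u t) k =
      coeff i u₀ k + ∫ τ in (0 : ℝ)..t, modeRhs s ν (u τ) k i := by
  filter_upwards [h.ae_linear_coeff_eq hs hT Complex.reCLM k i,
    h.ae_linear_coeff_eq hs hT Complex.imCLM k i, ae_restrict_mem measurableSet_Ioo] with t h1 h2 ht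
  have hi : IntervalIntegrable (fun τ => modeRhs s ν (u τ) k i) volume 0 t :=
    (h.intervalIntegrable_modeRhs hT.le k i).mono_set
      (uIcc_subset_uIcc_left (by rw [uIcc_of_le hT.le]; exact ⟨ht.1.le, ht.2.le⟩))
  apply Complex.ext
  · rw [Complex.add_re, re_integral hi]; exact h1
  · rw [Complex.add_im, im_integral hi]; exact h2

end IsWeakSolution

/-- The time derivative of the Hermitian product of two modes. -/
def pairRhs (s ν : ℝ) (v u : Torus → Vec) (k : Freq) : ℝ :=
  ∑ i, (modeRhs s ν v k i * (starRingEnd ℂ) (coeff i u k) +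
    coeff i v k * (starRingEnd ℂ) (modeRhs s ν u k i)).re

lemma integrableOn_pairRhs_summand {T : ℝ} {v u : ℝ → VecL2}
    (hv : MemLp v (⊤ : ℝ≥0∞) (volume.restrict (Ioo 0 T)))
    (hu : MemLp u (⊤ : ℝ≥0∞) (volume.restrict (Ioo 0 T))) (s ν : ℝ) (k : Freq) (i : Fin 3) :
    IntegrableOn (fun t => (modeRhs s ν (v t) k i * (starRingEnd ℂ) (coeff i (u t) k) +
      coeff i (v t) k * (starRingEnd ℂ) (modeRhs s ν (u t) k i)).re) (Ioo 0 T) := by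
  obtain ⟨M, hM⟩ := exists_norm_le hu
  obtain ⟨C, hC⟩ := exists_norm_modeRhs_le hu s ν k i
  have h1 : IntegrableOn (fun t => modeRhs s ν (v t) k i * (starRingEnd ℂ) (coeff i (u t) k))
      (Ioo 0 T) := by
    refine (integrableOn_modeRhs hv s ν k i).mul_bdd (c := M)
      (Complex.continuous_conj.comp_aestronglyMeasurable (aestronglyMeasurable_coeff hu.1 k i)) ?_
    filter_upwards [hM] with t ht
    rw [RCLike.norm_conj]
    exact (norm_coeff_le _ _ _).trans ht
  have h2 : IntegrableOn (fun t => coeff i (v t) k * (starRingEnd ℂ) (modeRhs s ν (u t) k i))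
      (Ioo 0 T) := by
    refine (integrableOn_coeff hv k i).mul_bdd (c := C)
      (Complex.continuous_conj.comp_aestronglyMeasurable
        (aestronglyMeasurable_modeRhs hu.1 s ν k i)) ?_
    filter_upwards [hC] with t ht
    rwa [RCLike.norm_conj]
  exact (h1.add h2).re

lemma ae_dotRe_eq {s ν T : ℝ} {u₀ : VecL2} {v u : ℝ → VecL2} (hs : 0 ≤ s) (hT : 0 < T)
    (hv : IsWeakSolution s ν T u₀ v) (hu : IsWeakSolution s ν T u₀ u) (k : Freq) :
    ∀ᵐ t ∂(volume.restrict (Ioo 0 T)), dotRe (coeffSeq (v t)) (coeffSeq (u t)) k =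
      dotRe (coeffSeq u₀) (coeffSeq u₀) k + ∫ τ in (0 : ℝ)..t, pairRhs s ν (v τ) (u τ) k := by
  have hva : ∀ᵐ t ∂(volume.restrict (Ioo 0 T)), ∀ i, coeff i (v t) k =
      coeff i u₀ k + ∫ τ in (0 : ℝ)..t, modeRhs s ν (v τ) k i :=
    ae_all_iff.2 fun i => hv.ae_coeff_eq hs hT k i
  have hua : ∀ᵐ t ∂(volume.restrict (Ioo 0 T)), ∀ i, coeff i (u t) k =
      coeff i u₀ k + ∫ τ in (0 : ℝ)..t, modeRhs s ν (u τ) k i :=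
    ae_all_iff.2 fun i => hu.ae_coeff_eq hs hT k i
  filter_upwards [hva, hua, ae_restrict_mem measurableSet_Ioo] with t h1 h2 ht
  have hsub : Ioc 0 t ⊆ Ioo 0 T := fun x hx => ⟨hx.1, hx.2.trans_lt ht.2⟩
  have hii : ∀ {p : ℝ → ℝ}, IntegrableOn p (Ioo 0 T) → IntervalIntegrable p volume 0 t :=
    fun hp => (intervalIntegrable_iff_integrableOn_Ioc_of_le ht.1.le).2 (hp.mono_set hsub)
  have hiic : ∀ {p : ℝ → ℂ}, IntegrableOn p (Ioo 0 T) → IntervalIntegrable p volume 0 t :=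
    fun hp => (intervalIntegrable_iff_integrableOn_Ioc_of_le ht.1.le).2 (hp.mono_set hsub)
  unfold pairRhs dotRe coeffSeq
  rw [intervalIntegral.integral_finsetSum fun i _ =>
    hii (integrableOn_pairRhs_summand hv.bounded hu.bounded s ν k i), ← Finset.sum_add_distrib]
  refine Finset.sum_congr rfl fun i _ => ?_
  rw [h1 i, h2 i, re_const_add_integral_mul_conj
    (hiic (integrableOn_modeRhs hv.bounded s ν k i))
    (hiic (integrableOn_modeRhs hu.bounded s ν k i))]
  congr 1
  rw [intervalIntegral.integral_of_le ht.1.le, intervalIntegral.integral_of_le ht.1.le]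
  apply integral_congr_ae
  -- Inside the integral the primitives are replaced by the modes themselves, with which they agree
  -- almost everywhere.
  filter_upwards [ae_restrict_of_ae_restrict_of_subset hsub hva,
    ae_restrict_of_ae_restrict_of_subset hsub hua] with τ h3 h4
  rw [h3 i, h4 i]

/-! ### The nonlinear terms -/

/-- The Leray matrix is real and symmetric, so it can be moved onto `c`, which it fixes. -/
lemma sum_modeRhs_mul_conj (s ν : ℝ) (f : Torus → Vec) {c : VecSeq} (hc : IsDivFreeSeq c)
    (k : Freq) :
    ∑ i, modeRhs s ν f k i * (starRingEnd ℂ) (c k i) =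
      -(ν * (waveNumber k ^ (2 * s) : ℝ)) * ∑ i, coeff i f k * (starRingEnd ℂ) (c k i) -
      ∑ l, divTensor f k l * (starRingEnd ℂ) (c k l) := by
  have hconj : ∑ j, (k j : ℂ) * (starRingEnd ℂ) (c k j) = 0 := by
    have := congrArg (starRingEnd ℂ) (hc k)
    simpa only [map_sum, map_mul, map_zero, map_intCast] using this
  have h1 : ∑ i, (∑ l, (lerayMatrix k i l : ℂ) * divTensor f k l) * (starRingEnd ℂ) (c k i) =
      ∑ l, divTensor f k l * (starRingEnd ℂ) (c k l) := by
    simp only [Finset.sum_mul]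
    rw [Finset.sum_comm]
    refine Finset.sum_congr rfl fun l _ => ?_
    rw [← sum_lerayMatrix_mul hconj l, Finset.mul_sum]
    refine Finset.sum_congr rfl fun i _ => ?_
    rw [lerayMatrix_comm]; ring
  rw [← h1, Finset.mul_sum, ← Finset.sum_sub_distrib]
  refine Finset.sum_congr rfl fun i _ => ?_
  unfold modeRhs
  ring

/-- The divergence form `div (f ⊗ f)` carries the frequency `k`, the convective form `k - p`; they
agree because `p` is orthogonal to the coefficient of `f` at `p`. -/
lemma hasSum_triTerm {f : Torus → Vec} (hf : MemLp f 2) (hd : IsDivFreeSeq (coeffSeq f))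
    (c : VecSeq) (k : Freq) :
    HasSum (fun p => triTerm (coeffSeq f) (coeffSeq f) c (k, p))
      (∑ l, divTensor f k l * (starRingEnd ℂ) (c k l)) := by
  have h : HasSum (fun p => ∑ l, (∑ j, 2 * Real.pi * Complex.I * k j *
      (coeff j f p * coeff l f (k - p))) * (starRingEnd ℂ) (c k l))
      (∑ l, divTensor f k l * (starRingEnd ℂ) (c k l)) :=
    hasSum_sum fun l _ => (hasSum_sum fun j _ => (hasSum_coeffMul hf hf l j k).mul_left _).mul_right _
  refine h.congr_fun fun p => ?_
  have hp := hd p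
  unfold triTerm
  simp only [coeffSeq, Fin.sum_univ_three, Pi.sub_apply, Int.cast_sub] at hp ⊢
  linear_combination (2 * Real.pi * Complex.I * (coeff 0 f (k - p) * (starRingEnd ℂ) (c k 0) +
    coeff 1 f (k - p) * (starRingEnd ℂ) (c k 1) +
    coeff 2 f (k - p) * (starRingEnd ℂ) (c k 2))) * -hp

lemma pairRhs_eq (s ν : ℝ) {v u : Torus → Vec} (hv : MemLp v 2) (hu : MemLp u 2)
    (hvd : IsDivFreeSeq (coeffSeq v)) (hud : IsDivFreeSeq (coeffSeq u)) (k : Freq) :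
    pairRhs s ν v u k =
      -(2 * ν) * (waveNumber k ^ (2 * s) * dotRe (coeffSeq v) (coeffSeq u) k) -
      (∑' p, triTerm (coeffSeq v) (coeffSeq v) (coeffSeq u) (k, p)).re -
      (∑' p, triTerm (coeffSeq u) (coeffSeq u) (coeffSeq v) (k, p)).re := by
  rw [(hasSum_triTerm hv hvd _ k).tsum_eq, (hasSum_triTerm hu hud _ k).tsum_eq]
  have h1 := congrArg Complex.re (sum_modeRhs_mul_conj s ν v hud k)
  have h2 := congrArg Complex.re (sum_modeRhs_mul_conj s ν u hvd k)
  have e : pairRhs s ν v u k =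
      (∑ i, modeRhs s ν v k i * (starRingEnd ℂ) (coeffSeq u k i)).re +
      (∑ i, modeRhs s ν u k i * (starRingEnd ℂ) (coeffSeq v k i)).re := by
    unfold pairRhs coeffSeq
    rw [Complex.re_sum, Complex.re_sum, ← Finset.sum_add_distrib]
    refine Finset.sum_congr rfl fun i _ => ?_
    simp only [Complex.add_re, Complex.mul_re, Complex.conj_re, Complex.conj_im]
    ring
  have e1 : ∀ z : ℂ, (-(ν * (waveNumber k ^ (2 * s) : ℝ) : ℂ) * z).re =
      -(ν * waveNumber k ^ (2 * s)) * z.re := by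
    intro z
    rw [show -(ν * (waveNumber k ^ (2 * s) : ℝ) : ℂ) = ((-(ν * waveNumber k ^ (2 * s)) : ℝ) : ℂ) by
      push_cast; ring, Complex.re_ofReal_mul]
  have e2 : (∑ i, coeff i u k * (starRingEnd ℂ) (coeffSeq v k i)).re =
      dotRe (coeffSeq v) (coeffSeq u) k := by
    unfold dotRe coeffSeq
    rw [Complex.re_sum]
    refine Finset.sum_congr rfl fun i _ => ?_
    simp only [Complex.mul_re, Complex.conj_re, Complex.conj_im]
    ring
  have e3 : (∑ i, coeff i v k * (starRingEnd ℂ) (coeffSeq u k i)).re =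
      dotRe (coeffSeq v) (coeffSeq u) k := by
    unfold dotRe coeffSeq
    rw [Complex.re_sum]
  rw [Complex.sub_re, e1, e3] at h1
  rw [Complex.sub_re, e1, e2] at h2
  rw [e, h1, h2]
  ring

/-! ### The identity for the inner product of two solutions -/

lemma enorm_re_le (z : ℂ) : ‖z.re‖ₑ ≤ ‖z‖ₑ := by
  rw [← ofReal_norm, ← ofReal_norm]
  exact ENNReal.ofReal_le_ofReal (Complex.abs_re_le_norm z)

lemma tsum_enorm_triTerm_lt_top {α β : ℝ} (hα : 0 ≤ α) (hβ : 0 ≤ β) (hαβ : 3 / 2 < α + β)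
    (a : VecL2) {b c : VecSeq} (hb : seqNormSq (α + 1) b < ∞) (hc : seqNormSq β c < ∞) :
    ∑' x, ‖triTerm (coeffSeq a) b c x‖ₑ < ∞ := by
  have h := tsum_enorm_triTerm_sq_le hα hβ (coeffSeq a) b c
  have ha : seqNormSq 0 (coeffSeq a) < ∞ := by rw [seqNormSq_zero_eq]; exact ENNReal.ofReal_lt_top
  have h2 := h.trans_lt (ENNReal.mul_lt_top (triConst_lt_top hαβ)
    (ENNReal.mul_lt_top (ENNReal.mul_lt_top ha hb) hc))
  exact (ENNReal.pow_lt_top_iff.1 h2).resolve_right (by norm_num)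

/-- With `a` bounded in `L²`, the squared estimate splits into a multiple of `‖b‖²` plus `‖c‖²`,
each integrable in time. -/
lemma lintegral_tsum_enorm_triTerm_lt_top {α β : ℝ} (hα : 0 ≤ α) (hβ : 0 ≤ β)
    (hαβ : 3 / 2 < α + β) {μ : Measure ℝ} {a b c : ℝ → VecL2} (ha : MemLp a (⊤ : ℝ≥0∞) μ)
    (hbm : AEStronglyMeasurable b μ) (hb : ∫⁻ t, seqNormSq (α + 1) (coeffSeq (b t)) ∂μ < ∞)
    (hc : ∫⁻ t, seqNormSq β (coeffSeq (c t)) ∂μ < ∞) :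
    ∫⁻ t, ∑' x, ‖triTerm (coeffSeq (a t)) (coeffSeq (b t)) (coeffSeq (c t)) x‖ₑ ∂μ < ∞ := by
  obtain ⟨M, hM⟩ := exists_norm_le ha
  have hle : ∀ᵐ t ∂μ, ∑' x, ‖triTerm (coeffSeq (a t)) (coeffSeq (b t)) (coeffSeq (c t)) x‖ₑ ≤
      (triConst (α + β) * ENNReal.ofReal (M ^ 2)) * seqNormSq (α + 1) (coeffSeq (b t)) +
        seqNormSq β (coeffSeq (c t)) := by
    filter_upwards [hM] with t ht
    apply le_add_of_sq_le_mul
    refine (tsum_enorm_triTerm_sq_le hα hβ _ _ _).trans ?_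
    rw [← mul_assoc, ← mul_assoc, seqNormSq_zero_eq]
    gcongr
  refine (lintegral_mono_ae hle).trans_lt ?_
  rw [lintegral_add_left' ((aemeasurable_seqNormSq hbm _).const_mul _),
    lintegral_const_mul'' _ (aemeasurable_seqNormSq hbm _)]
  exact ENNReal.add_lt_top.2 ⟨ENNReal.mul_lt_top
    (ENNReal.mul_lt_top (triConst_lt_top hαβ) ENNReal.ofReal_lt_top) hb, hc⟩

/-- The time derivative of the inner product of two solutions. -/
def crossRate (s ν : ℝ) (v u : VecSeq) : ℝ :=
  -(2 * ν) * dissip s v u + (triForm v u v).re - (triForm u u v).re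

lemma hasSum_tsum_triTerm_re {a b c : VecSeq} (h : ∑' x, ‖triTerm a b c x‖ₑ < ∞) :
    HasSum (fun k => (∑' p, triTerm a b c (k, p)).re) (triForm a b c).re := by
  have hs := summable_of_tsum_enorm_lt_top h
  unfold triForm
  rw [hs.tsum_prod]
  exact Complex.hasSum_re hs.prod.hasSum

lemma hasSum_pairRhs {s ν : ℝ} (hs : 0 ≤ s) {v u : VecL2}
    (hvd : IsDivFreeSeq (coeffSeq v)) (hud : IsDivFreeSeq (coeffSeq u))
    (hvs : seqNormSq s (coeffSeq v) < ∞) (hus : seqNormSq s (coeffSeq u) < ∞)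
    (h1 : ∑' x, ‖triTerm (coeffSeq v) (coeffSeq u) (coeffSeq v) x‖ₑ < ∞)
    (h2 : ∑' x, ‖triTerm (coeffSeq u) (coeffSeq u) (coeffSeq v) x‖ₑ < ∞) :
    HasSum (fun k => pairRhs s ν v u k) (crossRate s ν (coeffSeq v) (coeffSeq u)) := by
  have hvr := isRealSeq_coeffSeq v
  have hur := isRealSeq_coeffSeq u
  have a1 := (summable_waveNumber_mul_dotRe' hs hvs hus).hasSum.mul_left (-(2 * ν))
  have a2 := hasSum_tsum_triTerm_re (by rwa [tsum_enorm_triTerm_swap hvd hvr hur] :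
    ∑' x, ‖triTerm (coeffSeq v) (coeffSeq v) (coeffSeq u) x‖ₑ < ∞)
  have a3 := hasSum_tsum_triTerm_re h2
  have h := (a1.sub a2).sub a3
  -- The term `-b(v, v, u)` becomes `+b(v, u, v)`, whence the signs in `crossRate`.
  rw [triForm_swap hvd hvr hur, Complex.neg_re, sub_neg_eq_add] at h
  refine h.congr_fun fun k => ?_
  exact pairRhs_eq s ν (Lp.memLp v) (Lp.memLp u) hvd hud k

/-- This is the majorant that permits summing the mode identities under the time integral; the
derivative is moved from `v` to `u` in the first trilinear series. -/
lemma tsum_enorm_pairRhs_le {s ν : ℝ} (hs : 0 ≤ s) (hν : 0 ≤ ν) {v u : VecL2}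
    (hvd : IsDivFreeSeq (coeffSeq v)) (hud : IsDivFreeSeq (coeffSeq u)) :
    ∑' k, ‖pairRhs s ν v u k‖ₑ ≤
      (ENNReal.ofReal ν * seqNormSq s (coeffSeq v) + ENNReal.ofReal ν * seqNormSq s (coeffSeq u)) +
      ∑' x, ‖triTerm (coeffSeq v) (coeffSeq u) (coeffSeq v) x‖ₑ +
      ∑' x, ‖triTerm (coeffSeq u) (coeffSeq u) (coeffSeq v) x‖ₑ := by
  have hvr := isRealSeq_coeffSeq v
  have hur := isRealSeq_coeffSeq u
  rw [← tsum_enorm_triTerm_swap hvd hvr hur,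
    ENNReal.tsum_prod (f := fun k p => ‖triTerm (coeffSeq v) (coeffSeq v) (coeffSeq u) (k, p)‖ₑ),
    ENNReal.tsum_prod (f := fun k p => ‖triTerm (coeffSeq u) (coeffSeq u) (coeffSeq v) (k, p)‖ₑ),
    seqNormSq_eq_tsum_dotRe, seqNormSq_eq_tsum_dotRe, ← ENNReal.tsum_mul_left,
    ← ENNReal.tsum_mul_left, ← ENNReal.tsum_add, ← ENNReal.tsum_add, ← ENNReal.tsum_add]
  refine ENNReal.tsum_le_tsum fun k => ?_
  rw [pairRhs_eq s ν (Lp.memLp v) (Lp.memLp u) hvd hud k]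
  refine (enorm_sub_le (a := _) (b := _)).trans (add_le_add ((enorm_sub_le (a := _) (b := _)).trans
    (add_le_add ?_ ?_)) ?_)
  · have hw : 0 ≤ weight k ^ s := Real.rpow_nonneg (weight_pos k).le _
    rw [← ENNReal.ofReal_mul hν, ← ENNReal.ofReal_mul hν, ← ENNReal.ofReal_add
      (mul_nonneg hν (mul_nonneg hw (dotRe_self_nonneg _ k)))
      (mul_nonneg hν (mul_nonneg hw (dotRe_self_nonneg _ k))), ← ofReal_norm]
    apply ENNReal.ofReal_le_ofReal
    have hwn : 0 ≤ waveNumber k ^ (2 * s) := Real.rpow_nonneg (waveNumber_nonneg k) _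
    rw [Real.norm_eq_abs, abs_mul, abs_mul, abs_neg, abs_of_nonneg (by positivity : 0 ≤ 2 * ν),
      abs_of_nonneg hwn]
    calc _ = ν * (waveNumber k ^ (2 * s) * (2 * |dotRe (coeffSeq v) (coeffSeq u) k|)) := by ring
      _ ≤ ν * (weight k ^ s * (dotRe (coeffSeq v) (coeffSeq v) k +
            dotRe (coeffSeq u) (coeffSeq u) k)) := by
          gcongr
          · exact weight_rpow_ge hs k
          · exact two_mul_abs_dotRe_le _ _ k
      _ = _ := by ring
  · exact (enorm_re_le _).trans enorm_tsum_le_tsum_enorm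
  · exact (enorm_re_le _).trans enorm_tsum_le_tsum_enorm

/-- Only `u` needs regularity beyond the energy class. Taking `v = u` gives the energy identity for
the strong solution; the Leray–Hopf `v` gives the cross term. -/
lemma inner_eq_add_integral_crossRate {s ν T α : ℝ} {u₀ : VecL2} {v u : ℝ → VecL2} (hs : 0 ≤ s)
    (hν : 0 ≤ ν) (hT : 0 < T) (hα : 0 ≤ α) (hαs : 3 / 2 < α + s)
    (hv : IsWeakSolution s ν T u₀ v) (hu : IsWeakSolution s ν T u₀ u)
    (hreg : SqIntegrableInSobolev (α + 1) T u) :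
    IntegrableOn (fun t => crossRate s ν (coeffSeq (v t)) (coeffSeq (u t))) (Ioo 0 T) ∧
    ∀ᵐ t ∂(volume.restrict (Ioo 0 T)), inner ℝ (v t) (u t) =
      ‖u₀‖ ^ 2 + ∫ τ in (0 : ℝ)..t, crossRate s ν (coeffSeq (v τ)) (coeffSeq (u τ)) := by
  set μ := volume.restrict (Ioo 0 T) with hμ
  have hDm : ∀ k, AEStronglyMeasurable (fun t => pairRhs s ν (v t) (u t) k) μ := fun k =>
    (integrable_finsetSum _ fun i _ =>
      integrableOn_pairRhs_summand hv.bounded hu.bounded s ν k i).1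
  have hX1 := lintegral_tsum_enorm_triTerm_lt_top hα hs hαs hv.bounded hu.bounded.1 hreg
    hv.sqIntegrable
  have hX2 := lintegral_tsum_enorm_triTerm_lt_top hα hs hαs hu.bounded hu.bounded.1 hreg
    hv.sqIntegrable
  have m1 : AEMeasurable (fun t => ∑' x,
      ‖triTerm (coeffSeq (v t)) (coeffSeq (u t)) (coeffSeq (v t)) x‖ₑ) μ :=
    AEMeasurable.tsum fun x =>
      (aestronglyMeasurable_triTerm hv.bounded.1 hu.bounded.1 hv.bounded.1 x).aemeasurable.enorm
  have m2 : AEMeasurable (fun t => ∑' x,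
      ‖triTerm (coeffSeq (u t)) (coeffSeq (u t)) (coeffSeq (v t)) x‖ₑ) μ :=
    AEMeasurable.tsum fun x =>
      (aestronglyMeasurable_triTerm hu.bounded.1 hu.bounded.1 hv.bounded.1 x).aemeasurable.enorm
  have hfin : ∫⁻ t, ∑' k, ‖pairRhs s ν (v t) (u t) k‖ₑ ∂μ < ∞ := by
    have hle := (hv.ae_isDivFreeSeq.and hu.ae_isDivFreeSeq).mono fun t ht =>
      tsum_enorm_pairRhs_le hs hν ht.1 ht.2
    refine (lintegral_mono_ae hle).trans_lt ?_
    have n1 := aemeasurable_seqNormSq hv.bounded.1 s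
    have n2 := aemeasurable_seqNormSq hu.bounded.1 s
    rw [lintegral_add_right' _ m2, lintegral_add_right' _ m1,
      lintegral_add_right' _ (n2.const_mul _), lintegral_const_mul'' _ n1,
      lintegral_const_mul'' _ n2]
    refine ENNReal.add_lt_top.2 ⟨ENNReal.add_lt_top.2 ⟨ENNReal.add_lt_top.2 ⟨?_, ?_⟩, hX1⟩, hX2⟩
    · exact ENNReal.mul_lt_top ENNReal.ofReal_lt_top hv.sqIntegrable
    · exact ENNReal.mul_lt_top ENNReal.ofReal_lt_top hu.sqIntegrable
  have hsum : ∀ᵐ t ∂μ, HasSum (fun k => pairRhs s ν (v t) (u t) k)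
      (crossRate s ν (coeffSeq (v t)) (coeffSeq (u t))) := by
    filter_upwards [hv.ae_isDivFreeSeq, hu.ae_isDivFreeSeq, hv.ae_seqNormSq_lt_top,
      hu.ae_seqNormSq_lt_top, ae_lt_top' m1 hX1.ne, ae_lt_top' m2 hX2.ne] with t h1 h2 h3 h4 h5 h6
    exact hasSum_pairRhs hs h1 h2 h3 h4 h5 h6
  refine ⟨⟨?_, ?_⟩, ?_⟩
  · exact aestronglyMeasurable_of_tendsto_ae (Filter.atTop : Filter (Finset Freq))
      (f := fun F t => ∑ k ∈ F, pairRhs s ν (v t) (u t) k)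
      (fun F => Finset.aestronglyMeasurable_fun_sum _ fun k _ => hDm k) hsum
  · refine lt_of_le_of_lt (lintegral_mono_ae ?_) hfin
    filter_upwards [hsum] with t ht
    rw [← ht.tsum_eq]
    exact enorm_tsum_le_tsum_enorm
  -- There are countably many frequencies, so the mode identities hold simultaneously for almost
  -- every `t`.
  · filter_upwards [ae_all_iff.2 fun k => ae_dotRe_eq hs hT hv hu k,
      ae_restrict_mem measurableSet_Ioo] with t h1 ht
    have hsub : Ioc 0 t ⊆ Ioo 0 T := fun x hx => ⟨hx.1, hx.2.trans_lt ht.2⟩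
    have hmono : volume.restrict (Ioc 0 t) ≤ μ := Measure.restrict_mono hsub le_rfl
    have e : ∫ τ in (0 : ℝ)..t, crossRate s ν (coeffSeq (v τ)) (coeffSeq (u τ)) =
        ∑' k, ∫ τ in (0 : ℝ)..t, pairRhs s ν (v τ) (u τ) k := by
      simp only [intervalIntegral.integral_of_le ht.1.le]
      rw [← integral_tsum (fun k => (hDm k).mono_measure hmono)]
      · apply integral_congr_ae
        filter_upwards [ae_mono hmono hsum] with τ hτ
        exact hτ.tsum_eq.symm
      · rw [← lintegral_tsum fun k => ((hDm k).mono_measure hmono).aemeasurable.enorm]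
        exact ((lintegral_mono' hmono le_rfl).trans_lt hfin).ne
    have hS := hasSum_dotRe_inner (v t) (u t)
    have h0 := hasSum_dotRe_inner u₀ u₀
    have hdiff := hS.sub h0
    have hk : ∀ k, dotRe (coeffSeq (v t)) (coeffSeq (u t)) k - dotRe (coeffSeq u₀) (coeffSeq u₀) k =
        ∫ τ in (0 : ℝ)..t, pairRhs s ν (v τ) (u τ) k := fun k => by rw [h1 k]; ring
    simp only [hk] at hdiff
    rw [e, hdiff.tsum_eq, real_inner_self_eq_norm_sq]
    ring

lemma integrableOn_dissip_self {s T : ℝ} (hs : 0 ≤ s) {u : ℝ → VecL2}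
    (hu : AEStronglyMeasurable u (volume.restrict (Ioo 0 T))) (h : SqIntegrableInSobolev s T u) :
    IntegrableOn (fun t => dissip s (coeffSeq (u t)) (coeffSeq (u t))) (Ioo 0 T) := by
  have hfin := ae_lt_top' (aemeasurable_seqNormSq hu s) h.ne
  have hint : IntegrableOn (fun t => (seqNormSq s (coeffSeq (u t))).toReal) (Ioo 0 T) :=
    integrable_toReal_of_lintegral_ne_top (aemeasurable_seqNormSq hu s) h.ne
  refine Integrable.mono' hint ?_ ?_
  · refine aestronglyMeasurable_of_tendsto_ae (Filter.atTop : Filter (Finset Freq))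
      (f := fun F t => ∑ k ∈ F, waveNumber k ^ (2 * s) * dotRe (coeffSeq (u t)) (coeffSeq (u t)) k)
      (fun F => Finset.aestronglyMeasurable_fun_sum _ fun k _ =>
        (aestronglyMeasurable_dotRe hu hu k).const_mul _) ?_
    filter_upwards [hfin] with t ht
    exact (summable_waveNumber_mul_dotRe hs ht).hasSum
  · filter_upwards [hfin] with t ht
    rw [Real.norm_of_nonneg (dissip_self_nonneg _ _)]
    exact dissip_self_le hs ht

/-! ### The energy estimate for the difference -/

lemma abs_triForm_le {α s ε : ℝ} (hα : 0 ≤ α) (hs : 0 ≤ s) (hαs : 3 / 2 < α + s) (hε : 0 < ε)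
    (w : VecL2) {b : VecSeq} (hb : seqNormSq (α + 1) b < ∞)
    (hw : seqNormSq s (coeffSeq w) < ∞) :
    |(triForm (coeffSeq w) b (coeffSeq w)).re| ≤
      ε⁻¹ * ((triConst (α + s)).toReal * (seqNormSq (α + 1) b).toReal) * ‖w‖ ^ 2 +
        ε * (2 ^ s * (‖w‖ ^ 2 + dissip s (coeffSeq w) (coeffSeq w))) := by
  have hX := tsum_enorm_triTerm_lt_top hα hs hαs w hb hw
  have h1 : ‖triForm (coeffSeq w) b (coeffSeq w)‖ₑ ≤
      ∑' x, ‖triTerm (coeffSeq w) b (coeffSeq w) x‖ₑ := enorm_tsum_le_tsum_enorm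
  have h2 : ∑' x, ‖triTerm (coeffSeq w) b (coeffSeq w) x‖ₑ ≤
      ENNReal.ofReal ε⁻¹ * (triConst (α + s) * seqNormSq (α + 1) b) * ENNReal.ofReal (‖w‖ ^ 2) +
      ENNReal.ofReal ε * seqNormSq s (coeffSeq w) := by
    apply le_add_of_sq_le_mul
    refine (tsum_enorm_triTerm_sq_le hα hs _ _ _).trans (le_of_eq ?_)
    -- Young's inequality with a parameter: inserting `1 = ε⁻¹ ε` distributes the weights between
    -- the two summands.
    have he : ENNReal.ofReal ε⁻¹ * ENNReal.ofReal ε = 1 := by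
      rw [← ENNReal.ofReal_mul (by positivity), inv_mul_cancel₀ hε.ne', ENNReal.ofReal_one]
    rw [seqNormSq_zero_eq]
    calc _ = 1 * (triConst (α + s) * (ENNReal.ofReal (‖w‖ ^ 2) * seqNormSq (α + 1) b *
          seqNormSq s (coeffSeq w))) := (one_mul _).symm
      _ = _ := by rw [← he]; ring
  have hC := triConst_lt_top hαs
  have hA : ENNReal.ofReal ε⁻¹ * (triConst (α + s) * seqNormSq (α + 1) b) *
      ENNReal.ofReal (‖w‖ ^ 2) < ∞ := ENNReal.mul_lt_top (ENNReal.mul_lt_top ENNReal.ofReal_lt_top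
        (ENNReal.mul_lt_top hC hb)) ENNReal.ofReal_lt_top
  have hB : ENNReal.ofReal ε * seqNormSq s (coeffSeq w) < ∞ :=
    ENNReal.mul_lt_top ENNReal.ofReal_lt_top hw
  have h3 := ENNReal.toReal_mono (ENNReal.add_lt_top.2 ⟨hA, hB⟩).ne
    ((enorm_re_le _).trans (h1.trans h2))
  rw [ENNReal.toReal_add hA.ne hB.ne] at h3
  simp only [ENNReal.toReal_mul, toReal_enorm, Real.norm_eq_abs] at h3
  rw [ENNReal.toReal_ofReal (by positivity), ENNReal.toReal_ofReal (by positivity),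
    ENNReal.toReal_ofReal hε.le] at h3
  refine h3.trans ?_
  gcongr
  exact seqNormSq_toReal_le hs w hw

lemma seqNormSq_sub_lt_top {r : ℝ} {a b : VecSeq} (ha : seqNormSq r a < ∞)
    (hb : seqNormSq r b < ∞) : seqNormSq r (a - b) < ∞ := by
  have h : seqNormSq r (a - b) ≤ 2 * seqNormSq r a + 2 * seqNormSq r b := by
    simp only [seqNormSq_eq_tsum_dotRe]
    rw [← ENNReal.tsum_mul_left, ← ENNReal.tsum_mul_left, ← ENNReal.tsum_add]
    refine ENNReal.tsum_le_tsum fun k => ?_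
    have hw : 0 ≤ weight k ^ r := Real.rpow_nonneg (weight_pos k).le _
    rw [show (2 : ℝ≥0∞) = ENNReal.ofReal 2 by simp, ← ENNReal.ofReal_mul (by norm_num),
      ← ENNReal.ofReal_mul (by norm_num), ← ENNReal.ofReal_add
      (by have := mul_nonneg hw (dotRe_self_nonneg a k); positivity)
      (by have := mul_nonneg hw (dotRe_self_nonneg b k); positivity)]
    apply ENNReal.ofReal_le_ofReal
    have : dotRe (a - b) (a - b) k ≤ 2 * dotRe a a k + 2 * dotRe b b k := by
      simp only [dotRe_self, Finset.mul_sum, ← Finset.sum_add_distrib]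
      refine Finset.sum_le_sum fun i _ => ?_
      have h1 : ‖(a - b) k i‖ ≤ ‖a k i‖ + ‖b k i‖ := norm_sub_le _ _
      nlinarith [sq_nonneg (‖a k i‖ - ‖b k i‖), norm_nonneg ((a - b) k i)]
    nlinarith
  refine h.trans_lt (ENNReal.add_lt_top.2 ⟨?_, ?_⟩)
  · exact ENNReal.mul_lt_top (by simp) ha
  · exact ENNReal.mul_lt_top (by simp) hb

/-- The rate of change of `‖v - u‖²` is controlled by `‖v - u‖²`. -/
lemma rate_sub_le {s ν α : ℝ} (hs : 0 ≤ s) (hν : 0 < ν) (hα : 0 ≤ α) (hαs : 3 / 2 < α + s)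
    {v u : VecL2} (hvd : IsDivFreeSeq (coeffSeq v)) (hud : IsDivFreeSeq (coeffSeq u))
    (hvs : seqNormSq s (coeffSeq v) < ∞) (hus : seqNormSq s (coeffSeq u) < ∞)
    (hur : seqNormSq (α + 1) (coeffSeq u) < ∞) :
    -(2 * ν) * dissip s (coeffSeq v) (coeffSeq v) + crossRate s ν (coeffSeq u) (coeffSeq u) -
        2 * crossRate s ν (coeffSeq v) (coeffSeq u) ≤
      (2 * (ν / 2 ^ s)⁻¹ * (triConst (α + s)).toReal * (seqNormSq (α + 1) (coeffSeq u)).toReal +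
        2 * ν) * ‖v - u‖ ^ 2 := by
  have h2s : (0 : ℝ) < 2 ^ s := by positivity
  have hd := dissip_sub hs hvs hus
  have hws : seqNormSq s (coeffSeq (v - u : VecL2)) < ∞ := by
    rw [coeffSeq_sub]; exact seqNormSq_sub_lt_top hvs hus
  have htri := triForm_sub hud hvd (isRealSeq_coeffSeq u)
    (tsum_enorm_triTerm_lt_top hα hs hαs v hur hvs) (tsum_enorm_triTerm_lt_top hα hs hαs u hur hvs)
    (tsum_enorm_triTerm_lt_top hα hs hαs v hur hus) (tsum_enorm_triTerm_lt_top hα hs hαs u hur hus)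
  -- With `ε = ν / 2 ^ s` the factor `2 ^ s` cancels. Twice the cubic term then costs exactly `2ν`
  -- times the dissipation of `v - u`, all that is available, plus `2ν ‖v - u‖²`.
  have hbd := abs_triForm_le hα hs hαs (div_pos hν h2s) (v - u) hur hws
  rw [← coeffSeq_sub] at hd htri
  have hre := congrArg Complex.re htri
  rw [Complex.sub_re] at hre
  have hlow := neg_abs_le (triForm (coeffSeq (v - u : VecL2)) (coeffSeq u)
    (coeffSeq (v - u : VecL2))).re
  have e : ν / 2 ^ s * (2 ^ s * (‖v - u‖ ^ 2 +
      dissip s (coeffSeq (v - u : VecL2)) (coeffSeq (v - u : VecL2)))) = ν * (‖v - u‖ ^ 2 +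
      dissip s (coeffSeq (v - u : VecL2)) (coeffSeq (v - u : VecL2))) := by
    field_simp
  rw [e] at hbd
  unfold crossRate
  linarith [congrArg (fun x => ν * x) hd]

lemma IsLerayHopf.ae_norm_sq_le {s ν T : ℝ} (hs : 0 ≤ s) {u₀ : VecL2} {v : ℝ → VecL2}
    (hv : IsLerayHopf s ν T u₀ v) :
    ∀ᵐ t ∂(volume.restrict (Ioo 0 T)), ‖v t‖ ^ 2 ≤ ‖u₀‖ ^ 2 +
      ∫ τ in (0 : ℝ)..t, -(2 * ν) * dissip s (coeffSeq (v τ)) (coeffSeq (v τ)) := by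
  filter_upwards [ae_restrict_mem measurableSet_Ioo] with t ht
  have hsub : Ioc 0 t ⊆ Ioo 0 T := fun x hx => ⟨hx.1, hx.2.trans_lt ht.2⟩
  have h := hv.energy t ⟨ht.1.le, ht.2.le⟩
  have e : ∫ τ in (0 : ℝ)..t, fracInner (s / 2) (v τ) (v τ) =
      ∫ τ in (0 : ℝ)..t, dissip s (coeffSeq (v τ)) (coeffSeq (v τ)) := by
    rw [intervalIntegral.integral_of_le ht.1.le, intervalIntegral.integral_of_le ht.1.le]
    apply integral_congr_ae
    filter_upwards [ae_restrict_of_ae_restrict_of_subset hsub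
      hv.toIsWeakSolution.ae_seqNormSq_lt_top] with τ hτ
    exact fracInner_eq_dissip hs hτ hτ
  rw [e] at h
  rw [intervalIntegral.integral_const_mul]
  linarith

lemma ae_eq_of_sqIntegrableInSobolev {s ν T α : ℝ} (hs : 0 ≤ s) (hν : 0 < ν) (hT : 0 < T)
    (hα : 0 ≤ α) (hαs : 3 / 2 < α + s) {u₀ : VecL2} {u v : ℝ → VecL2}
    (hu : IsWeakSolution s ν T u₀ u) (hreg : SqIntegrableInSobolev (α + 1) T u)
    (hv : IsLerayHopf s ν T u₀ v) :
    ∀ᵐ t ∂(volume.restrict (Ioo 0 T)), v t = u t := by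
  have hvw := hv.toIsWeakSolution
  obtain ⟨iuu, huu⟩ := inner_eq_add_integral_crossRate hs hν.le hT hα hαs hu hu hreg
  obtain ⟨ivu, hvu⟩ := inner_eq_add_integral_crossRate hs hν.le hT hα hαs hvw hu hreg
  have idv := (integrableOn_dissip_self hs hvw.bounded.1 hvw.sqIntegrable).const_mul (-(2 * ν))
  have iB : IntegrableOn (fun t => (seqNormSq (α + 1) (coeffSeq (u t))).toReal) (Ioo 0 T) :=
    integrable_toReal_of_lintegral_ne_top (aemeasurable_seqNormSq hu.bounded.1 _) hreg.ne
  set K : ℝ → ℝ := fun t => 2 * (ν / 2 ^ s)⁻¹ * (triConst (α + s)).toReal *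
    (seqNormSq (α + 1) (coeffSeq (u t))).toReal + 2 * ν with hKdef
  have iK : IntegrableOn K (Ioo 0 T) := (iB.const_mul _).add (integrable_const _)
  have hK0 : ∀ t, 0 ≤ K t := fun t => by simp only [hKdef]; positivity
  obtain ⟨M, hM⟩ := exists_norm_le (hvw.bounded.sub hu.bounded)
  have iKf : IntegrableOn (fun t => K t * ‖v t - u t‖ ^ 2) (Ioo 0 T) := by
    refine iK.mul_bdd (c := M ^ 2) ((hvw.bounded.1.sub hu.bounded.1).norm.pow 2) ?_
    filter_upwards [hM] with t ht
    rw [Real.norm_of_nonneg (by positivity)]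
    exact pow_le_pow_left₀ (norm_nonneg _) ht 2
  have hrate : ∀ᵐ t ∂(volume.restrict (Ioo 0 T)),
      -(2 * ν) * dissip s (coeffSeq (v t)) (coeffSeq (v t)) +
        crossRate s ν (coeffSeq (u t)) (coeffSeq (u t)) -
        2 * crossRate s ν (coeffSeq (v t)) (coeffSeq (u t)) ≤ K t * ‖v t - u t‖ ^ 2 := by
    filter_upwards [hvw.ae_isDivFreeSeq, hu.ae_isDivFreeSeq, hvw.ae_seqNormSq_lt_top,
      hu.ae_seqNormSq_lt_top, ae_lt_top' (aemeasurable_seqNormSq hu.bounded.1 _) hreg.ne]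
      with t h1 h2 h3 h4 h5
    exact rate_sub_le hs hν hα hαs h1 h2 h3 h4 h5
  have key : ∀ᵐ t ∂(volume.restrict (Ioo 0 T)),
      ‖v t - u t‖ ^ 2 ≤ ∫ τ in (0 : ℝ)..t, K τ * ‖v τ - u τ‖ ^ 2 := by
    filter_upwards [huu, hvu, hv.ae_norm_sq_le hs, ae_restrict_mem measurableSet_Ioo]
      with t h1 h2 h3 ht
    have hsub : Ioc 0 t ⊆ Ioo 0 T := fun x hx => ⟨hx.1, hx.2.trans_lt ht.2⟩
    rw [real_inner_self_eq_norm_sq] at h1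
    -- The square is expanded and each piece replaced: `‖v‖²` by the energy inequality, `‖u‖²` and
    -- `⟪v, u⟫` by the identities. The initial terms cancel, as `1 + 1 - 2 = 0` times `‖u₀‖²`.
    rw [norm_sub_sq_real]
    simp only [intervalIntegral.integral_of_le ht.1.le] at h1 h2 h3 ⊢
    have j1 := IntegrableOn.mono_set idv hsub
    have j2 := iuu.mono_set hsub
    have j3 := (ivu.mono_set hsub).const_mul 2
    have h4 := integral_mono_ae ((j1.add j2).sub j3) (iKf.mono_set hsub)
      (ae_restrict_of_ae_restrict_of_subset hsub hrate)
    have h5 : ∫ τ in Ioc 0 t, (((fun τ => -(2 * ν) * dissip s (coeffSeq (v τ)) (coeffSeq (v τ))) +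
        fun τ => crossRate s ν (coeffSeq (u τ)) (coeffSeq (u τ))) -
        fun τ => 2 * crossRate s ν (coeffSeq (v τ)) (coeffSeq (u τ))) τ =
        (∫ τ in Ioc 0 t, -(2 * ν) * dissip s (coeffSeq (v τ)) (coeffSeq (v τ))) +
        (∫ τ in Ioc 0 t, crossRate s ν (coeffSeq (u τ)) (coeffSeq (u τ))) -
        2 * ∫ τ in Ioc 0 t, crossRate s ν (coeffSeq (v τ)) (coeffSeq (u τ)) := by
      rw [integral_sub' (j1.add j2) j3, integral_add' j1 j2, integral_const_mul 2]
    rw [h5] at h4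
    linarith
  filter_upwards [ae_nonpos_of_le_integral_mul hT iK iKf hK0 (fun t => by positivity) key]
    with t ht
  have h0 : ‖v t - u t‖ ^ 2 = 0 := le_antisymm ht (by positivity)
  exact sub_eq_zero.1 (norm_eq_zero.1 (pow_eq_zero_iff two_ne_zero |>.1 h0))

/-! ### The admissible exponent, and equality at every time -/

/-- With `α = m + s - 1` the condition reads `2s > 5/2 - m`, that is `s > 3/4`, `s > 1/4` or `s >
-1/4` for `m = 1, 2, 3`; the thresholds `5/6`, `1/3` and `0` suffice. -/
lemma exists_strongOrder_eq {s : ℝ} (hs : 0 < s) :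
    ∃ α, 0 ≤ α ∧ 3 / 2 < α + s ∧ strongOrder s + s = α + 1 := by
  refine ⟨strongOrder s + s - 1, ?_, ?_, by ring⟩ <;> unfold strongOrder <;> split_ifs <;> linarith

/-- Against a fixed `w` the two pairings are continuous real functions that agree almost everywhere
on a nondegenerate interval, hence also at its endpoints. -/
lemma eqOn_of_weaklyContinuous {T : ℝ} (hT : 0 < T) {u v : ℝ → VecL2} (hu : WeaklyContinuous T u)
    (hv : WeaklyContinuous T v) (h : ∀ᵐ t ∂(volume.restrict (Ioo 0 T)), u t = v t) :
    ∀ t ∈ Icc 0 T, u t = v t := by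
  intro t ht
  refine ext_inner_right ℝ fun w => ?_
  refine Measure.eqOn_Icc_of_ae_eq volume hT.ne ?_ (hu w) (hv w) ht
  rw [← restrict_Ioo_eq_restrict_Icc]
  filter_upwards [h] with τ hτ
  rw [hτ]

end FracNS

end

theorem theorem5p3 (s ν T : ℝ) (hs : 0 < s) (hν : 0 < ν) (hT : 0 < T)
    (u₀ : FracNS.VecL2) (uS uW : ℝ → FracNS.VecL2)
    (hS : FracNS.IsStrongSolution s ν T u₀ uS)
    (hW : FracNS.IsLerayHopf s ν T u₀ uW) :
    (∀ᵐ t ∂(volume.restrict (Ioo 0 T)), uW t = uS t) ∧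
      (FracNS.WeaklyContinuous T uW → FracNS.WeaklyContinuous T uS →
        ∀ t ∈ Icc 0 T, uW t = uS t) := by
  obtain ⟨α, hα, hαs, e⟩ := FracNS.exists_strongOrder_eq hs
  have h := FracNS.ae_eq_of_sqIntegrableInSobolev hs.le hν hT hα hαs hS.toIsWeakSolution
    (e ▸ hS.strong_sqIntegrable) hW
  exact ⟨h, fun h1 h2 => FracNS.eqOn_of_weaklyContinuous hT h1 h2 h⟩
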